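/- **Setting.** Let $X$ be an irreducible complex algebraic variety (an integral separated scheme of finite type over $\mathbb C$; points of $X$ are closed points). A *collection* $\mathcal E=(E_1,\dots,E_k)$ consists of finite-dimensional base-point free linear series $E_i\subset H^0(X,\mathcal L_i)$, where the $\mathcal L_i$ are line bundles on $X$. For $J\subset\{1,\dots,k\}$ let $E_J=\prod_{j\in J}E_j\subset H^0(X,\bigotimes_{j\in J}\mathcal L_j)$ be the span of all products $\bigotimes_{j\in J}s_j$ with $s_j\in E_j$ (for $J=\varnothing$: the constants $\mathbb C\subset H^0(X,\mathcal O_X)$), let $\Phi_J:X\to\mathbb P(E_J^*)$ be its Kodaira map, which sends $x$ to the hyperplane of the sections in $E_J$ vanishing at $x$, and let $\tau_J=\dim\Phi_J(X)$. The *defect* is $\operatorname{def}(E_J)=\tau_J-|J|$ and the *minimal defect* is $\operatorname{d}(\mathcal E)=\min_{J\subset\{1,\dots,k\}}\operatorname{def}(E_J)$. A subcollection $J$ is *essential* if $\operatorname{def}(E_J)=\operatorname{d}(\mathcal E)$ and $\operatorname{def}(E_I)>\operatorname{def}(E_J)$ for every proper subset $I\subsetneq J$. Let $\mathbf E=E_1\times\dots\times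 E_k$ and, for $\mathbf s\in\mathbf E$, let $Z_{\mathbf s}\subset X$ be the common zero set of $s_1,\dots,s_k$. The *consistency variety* $R_{\mathbf E}\subset\mathbf E$ is the Zariski closure of $\{\mathbf s: Z_{\mathbf s}\neq\varnothing\}$. The collection is *generically inconsistent* if $Z_{\mathbf s}=\varnothing$ for all $\mathbf s$ in some non-empty Zariski open subset of $\mathbf E$. Two collections $\mathcal E$ and $\mathcal W$ on $X$ (possibly of different lengths) are *equivalent* if there are non-empty Zariski open subsets $U\subset R_{\mathbf E}$ and $V\subset R_{\mathbf W}$ such that for every $u\in U$ there is $v\in V$ with $Z_u=Z_v$, and for every $v\in V$ there is $u\in U$ with $Z_u=Z_v$. **Theorem (Reduction theorem).** Every generically inconsistent collection $\mathcal E=(E_1,\dots,E_k)$ on $X$ is equivalent to some collection $\mathcal W$ on $X$ with $\operatorname{d}(\mathcal W)=-1$. Moreover, if $\operatorname{d}(\mathcal E)=-d$ and $J=\{1,\dots,r\}$ is an essential subcollection of $\mathcal E$, then $d\le r$ and the collection $\mathcal W=(W_1,\dots,W_{k-d+1})$ given by $$W_1=\dots=W_{r-d+1}=E_J=E_1\cdots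 E_r,\qquad W_{r-d+2}=E_{r+1},\ \dots,\ W_{k-d+1}=E_k$$ satisfies $\operatorname{d}(\mathcal W)=-1$ and is equivalent to $\mathcal E$. -/

import Mathlib

open CategoryTheory AlgebraicGeometry TopologicalSpace
open scoped Topology LinearAlgebra.Projectivization

noncomputable section

/-- An irreducible complex algebraic variety: an integral, separated scheme of finite type
over `ℂ`. -/
structure ComplexVariety where
  carrier : Scheme.{0}
  str : carrier ⟶ Spec (CommRingCat.of ℂ)
  isIntegral : IsIntegral carrier
  isSeparated : IsSeparated str
  locallyOfFiniteType : LocallyOfFiniteType str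
  quasiCompact : QuasiCompact str

attribute [instance] ComplexVariety.isIntegral ComplexVariety.isSeparated
  ComplexVariety.locallyOfFiniteType ComplexVariety.quasiCompact

namespace ComplexVariety

/-- The ring of regular functions on an open subset. -/
abbrev Reg (X : ComplexVariety) (U : X.carrier.Opens) : CommRingCat.{0} :=
  X.carrier.presheaf.obj (Opposite.op U)

/-- Constants are regular functions, through the structure morphism. -/
def const (X : ComplexVariety) (U : X.carrier.Opens) : ℂ →+* X.Reg U :=
  (X.str.appLE ⊤ U le_top).hom.comp (Scheme.ΓSpecIso (CommRingCat.of ℂ)).inv.hom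

instance regAlgebra (X : ComplexVariety) (U : X.carrier.Opens) : Algebra ℂ (X.Reg U) :=
  (X.const U).toAlgebra

/-- Restriction of regular functions. -/
def res (X : ComplexVariety) {U V : X.carrier.Opens} (h : V ≤ U) : X.Reg U →ₐ[ℂ] X.Reg V where
  toRingHom := (X.carrier.presheaf.map (homOfLE h).op).hom
  commutes' c := by
    change (X.carrier.presheaf.map (homOfLE h).op).hom (X.const U c) = X.const V c
    have := Scheme.Hom.appLE_map X.str (U := ⊤) (V := U) le_top (homOfLE h).op
    rw [const, const, ← this]
    rfl

theorem res_res (X : ComplexVariety) {U V W : X.carrier.Opens} (h : V ≤ U) (h' : W ≤ V)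
    (f : X.Reg U) : X.res h' (X.res h f) = X.res (h'.trans h) f := by
  change (X.carrier.presheaf.map (homOfLE h).op ≫ X.carrier.presheaf.map (homOfLE h').op).hom f = _
  rw [← Functor.map_comp]
  rfl

/-- The value of a regular function at a point, in the residue field. -/
def eval (X : ComplexVariety) {U : X.carrier.Opens} {x : X.carrier} (hx : x ∈ U) :
    X.Reg U →+* X.carrier.residueField x :=
  (X.carrier.evaluation U x hx).hom

theorem eval_res (X : ComplexVariety) {U V : X.carrier.Opens} (h : V ≤ U) {x : X.carrier}
    (hx : x ∈ V) (f : X.Reg U) : X.eval hx (X.res h f) = X.eval (h hx) f := by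
  change (X.carrier.residue x).hom ((X.carrier.presheaf.germ V x hx).hom
    ((X.carrier.presheaf.map (homOfLE h).op).hom f)) =
    (X.carrier.residue x).hom ((X.carrier.presheaf.germ U x (h hx)).hom f)
  congr 1
  exact TopCat.Presheaf.germ_res_apply X.carrier.presheaf (homOfLE h) x hx f

/-- The points of the variety in the classical sense: the closed points of the scheme. -/
def points (X : ComplexVariety) : Set X.carrier := {x | IsClosed {x}}

end ComplexVariety

/-- A line bundle on `X`, given by an open cover and an invertible cocycle of transition
functions. -/
structure LineBundle (X : ComplexVariety) where
  ι : Type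
  U : ι → X.carrier.Opens
  cover : ∀ x : X.carrier, ∃ i, x ∈ U i
  g : ∀ i j, (X.Reg (U i ⊓ U j))ˣ
  cocycle : ∀ i j l,
    X.res (V := U i ⊓ U j ⊓ U l) inf_le_left (g i j : X.Reg (U i ⊓ U j)) *
      X.res (le_inf (inf_le_left.trans inf_le_right) inf_le_right) (g j l : X.Reg (U j ⊓ U l)) =
      X.res (le_inf (inf_le_left.trans inf_le_left) inf_le_right) (g i l : X.Reg (U i ⊓ U l))

namespace LineBundle

variable {X : ComplexVariety}

/-- The space `H⁰(X, L)`: families of regular functions on the charts that are compatible under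
the transition functions. -/
def globalSections (L : LineBundle X) : Submodule ℂ (∀ i, X.Reg (L.U i)) where
  carrier := {s | ∀ i j, X.res (V := L.U i ⊓ L.U j) inf_le_left (s i) =
    (L.g i j : X.Reg (L.U i ⊓ L.U j)) * X.res inf_le_right (s j)}
  add_mem' := by
    intro s t hs ht i j
    simp only [Pi.add_apply, map_add, hs i j, ht i j, mul_add]
  zero_mem' := by
    intro i j
    simp
  smul_mem' := by
    intro c s hs i j
    simp only [Pi.smul_apply, map_smul, hs i j, mul_smul_comm]

/-- The subspace of the families whose value at `x` is zero in every chart around `x`. -/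
def vanishing (L : LineBundle X) (x : X.carrier) : Submodule ℂ (∀ i, X.Reg (L.U i)) where
  carrier := {s | ∀ i (hx : x ∈ L.U i), X.eval hx (s i) = 0}
  add_mem' := by
    intro s t hs ht i hx
    simp [hs i hx, ht i hx]
  zero_mem' := by
    intro i hx
    simp
  smul_mem' := by
    intro c s hs i hx
    simp [Algebra.smul_def, hs i hx]

/-- The tensor product of a finite family of line bundles: the charts are the intersections of
charts, and the transition functions are multiplied. -/
@[reducible] def tensor {κ : Type} [Fintype κ] (L : κ → LineBundle X) : LineBundle X where
  ι := ∀ j, (L j).ι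
  U a := Finset.univ.inf fun j => (L j).U (a j)
  cover x := by
    choose a ha using fun j => (L j).cover x
    refine ⟨a, ?_⟩
    rw [← SetLike.mem_coe, Opens.coe_finset_inf]
    simpa using ha
  g a b := ∏ j, Units.map
    (X.res (inf_le_inf (Finset.inf_le (Finset.mem_univ j)) (Finset.inf_le (Finset.mem_univ j)) :
      (Finset.univ.inf fun j => (L j).U (a j)) ⊓ (Finset.univ.inf fun j => (L j).U (b j)) ≤
        (L j).U (a j) ⊓ (L j).U (b j)) : _ →* _) ((L j).g (a j) (b j))
  cocycle a b c := by
    simp only [Units.coe_prod, Units.coe_map, map_prod, ← Finset.prod_mul_distrib]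
    refine Finset.prod_congr rfl fun j _ => ?_
    have h := congrArg (X.res (inf_le_inf (inf_le_inf (Finset.inf_le (Finset.mem_univ j))
      (Finset.inf_le (Finset.mem_univ j))) (Finset.inf_le (Finset.mem_univ j)) :
      (Finset.univ.inf fun j => (L j).U (a j)) ⊓ (Finset.univ.inf fun j => (L j).U (b j)) ⊓
        (Finset.univ.inf fun j => (L j).U (c j)) ≤
        (L j).U (a j) ⊓ (L j).U (b j) ⊓ (L j).U (c j))) ((L j).cocycle (a j) (b j) (c j))
    simp only [map_mul, ComplexVariety.res_res] at h
    simpa [ComplexVariety.res_res] using h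

/-- The multiplication `(s_j)_j ↦ ⨂_j s_j` of sections, chart by chart. -/
def tensorSections {κ : Type} [Fintype κ] (L : κ → LineBundle X) :
    MultilinearMap ℂ (fun j => ∀ i, X.Reg ((L j).U i)) (∀ a, X.Reg ((tensor L).U a)) :=
  MultilinearMap.pi fun a =>
    (MultilinearMap.mkPiAlgebra ℂ κ (X.Reg ((tensor L).U a))).compLinearMap fun j =>
      (X.res (Finset.inf_le (Finset.mem_univ j) : (tensor L).U a ≤ (L j).U (a j))).toLinearMap ∘ₗ
        LinearMap.proj (a j)

theorem tensorSections_apply {κ : Type} [Fintype κ] (L : κ → LineBundle X)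
    (s : ∀ j i, X.Reg ((L j).U i)) (a : (tensor L).ι) :
    tensorSections L s a = ∏ j, X.res (Finset.inf_le (Finset.mem_univ j)) (s j (a j)) := by
  simp only [tensorSections, MultilinearMap.pi_apply, MultilinearMap.compLinearMap_apply,
    MultilinearMap.mkPiAlgebra_apply]
  rfl

end LineBundle

/-- A finite-dimensional base-point free linear series on `X`. -/
structure LinearSeries (X : ComplexVariety) where
  bundle : LineBundle X
  space : Submodule ℂ (∀ i, X.Reg (bundle.U i))
  le_globalSections : space ≤ bundle.globalSections
  finite : Module.Finite ℂ space
  basePointFree : ∀ x : X.carrier, ∃ s ∈ space, s ∉ bundle.vanishing x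

attribute [instance] LinearSeries.finite

/-- The Zariski topology of a finite-dimensional complex vector space; the non-vanishing loci of
polynomial functions are a basis. -/
@[reducible] def zariskiTopology (V : Type*) [AddCommGroup V] [Module ℂ V] : TopologicalSpace V :=
  generateFrom {O | ∃ p : MvPolynomial (Module.Dual ℂ V) ℂ,
    O = {v | MvPolynomial.eval (fun φ => φ v) p ≠ 0}}

/-- The Zariski topology of a projective space: the quotient topology of the punctured vector
space. -/
@[reducible] def projectiveZariskiTopology (V : Type*) [AddCommGroup V] [Module ℂ V] :
    TopologicalSpace (ℙ ℂ V) :=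
  coinduced (Projectivization.mk' ℂ) (induced Subtype.val (zariskiTopology V))

namespace LinearSeries

variable {X : ComplexVariety}

/-- The hyperplane `E_x` of the sections in `E` that vanish at `x`. -/
def hyperplane (E : LinearSeries X) (x : X.carrier) : Submodule ℂ E.space :=
  (E.bundle.vanishing x).comap E.space.subtype

/-- The image `Y_E ⊆ ℙ(E*)` of the Kodaira map, which sends a point `x` to the hyperplane `E_x`;
a point of `ℙ(E*)` is identified with the kernel of any functional representing it. -/
def kodairaImage (E : LinearSeries X) : Set (ℙ ℂ (Module.Dual ℂ E.space)) :=
  {ℓ | ∃ x ∈ X.points, LinearMap.ker ℓ.rep = E.hyperplane x}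

/-- The dimension `τ_E` of the image of the Kodaira map. -/
def tau (E : LinearSeries X) : ℕ :=
  letI : TopologicalSpace E.kodairaImage :=
    induced Subtype.val (projectiveZariskiTopology (Module.Dual ℂ E.space))
  ((topologicalKrullDim E.kodairaImage).unbotD 0).toNat

/-- The product of a finite family of linear series: the span of all products of sections.
The empty product is the space of constants in the trivial bundle. -/
def prod {κ : Type} [Fintype κ] (E : κ → LinearSeries X) : LinearSeries X where
  bundle := LineBundle.tensor fun j => (E j).bundle
  space := Submodule.span ℂ {t | ∃ s : ∀ j, (E j).space,
    t = LineBundle.tensorSections (fun j => (E j).bundle) fun j => (s j).1}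
  le_globalSections := by
    rw [Submodule.span_le]
    rintro _ ⟨s, rfl⟩ a b
    rw [LineBundle.tensorSections_apply, LineBundle.tensorSections_apply, map_prod, map_prod]
    rw [Units.coe_prod, ← Finset.prod_mul_distrib]
    refine Finset.prod_congr rfl fun j _ => ?_
    have h := congrArg (X.res (inf_le_inf (Finset.inf_le (Finset.mem_univ j))
      (Finset.inf_le (Finset.mem_univ j)) :
      (Finset.univ.inf fun j => (E j).bundle.U (a j)) ⊓
        (Finset.univ.inf fun j => (E j).bundle.U (b j)) ≤
        (E j).bundle.U (a j) ⊓ (E j).bundle.U (b j)))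
      ((E j).le_globalSections (s j).2 (a j) (b j))
    simp only [map_mul, ComplexVariety.res_res] at h
    simpa [ComplexVariety.res_res] using h
  finite := by
    let M := (LineBundle.tensorSections fun j => (E j).bundle).compLinearMap
      fun j => (E j).space.subtype
    have hfin : Module.Finite ℂ (LinearMap.range (PiTensorProduct.lift M)) := inferInstance
    refine Submodule.finiteDimensional_of_le (S₂ := LinearMap.range (PiTensorProduct.lift M)) ?_
    rw [Submodule.span_le]
    rintro _ ⟨s, rfl⟩
    exact ⟨PiTensorProduct.tprod ℂ s, by simp [M]⟩
  basePointFree x := by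
    choose s hs hx using fun j => (E j).basePointFree x
    have hx' : ∀ j, ∃ i, ∃ h : x ∈ (E j).bundle.U i, X.eval h (s j i) ≠ 0 := by
      intro j
      by_contra! hc
      exact hx j fun i h => hc i h
    choose a ha hne using hx'
    refine ⟨_, Submodule.subset_span ⟨fun j => ⟨s j, hs j⟩, rfl⟩, fun hv => ?_⟩
    have hmem : x ∈ (LineBundle.tensor fun j => (E j).bundle).U a := by
      change x ∈ Finset.univ.inf fun j => (E j).bundle.U (a j)
      rw [← SetLike.mem_coe, Opens.coe_finset_inf]
      simpa using ha
    have h0 := hv a hmem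
    rw [LineBundle.tensorSections_apply, map_prod, Finset.prod_eq_zero_iff] at h0
    obtain ⟨j, -, hj⟩ := h0
    rw [ComplexVariety.eval_res] at hj
    exact hne j hj

end LinearSeries

/-- A collection `E_1, …, E_k` of linear series on `X`. -/
abbrev Collection (X : ComplexVariety) (k : ℕ) := Fin k → LinearSeries X

namespace Collection

variable {X : ComplexVariety} {k : ℕ}

/-- The product `E_J = ∏_{j ∈ J} E_j`. -/
def prodOn (E : Collection X k) (J : Finset (Fin k)) : LinearSeries X :=
  LinearSeries.prod fun j : J => E j

/-- The defect `def(E_J) = τ_J - |J|`. -/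
def defect (E : Collection X k) (J : Finset (Fin k)) : ℤ :=
  ((E.prodOn J).tau : ℤ) - J.card

/-- The minimal defect `d(E)`: the minimum of `def(E_J)` over all `J ⊆ {1, …, k}`. -/
def minDefect (E : Collection X k) : ℤ :=
  Finset.univ.inf' Finset.univ_nonempty E.defect

/-- `J` is an essential subcollection: it has minimal defect, and each of its proper subsets has
strictly larger defect. -/
def IsEssential (E : Collection X k) (J : Finset (Fin k)) : Prop :=
  E.defect J = E.minDefect ∧ ∀ I, I ⊂ J → E.defect J < E.defect I

/-- The space of systems `𝐄 = E_1 × ⋯ × E_k`. -/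
abbrev Systems (E : Collection X k) : Type := ∀ i, (E i).space

/-- The zero set in `X` of the system `s_1 = ⋯ = s_k = 0`. -/
def zeroSet (E : Collection X k) (s : E.Systems) : Set X.carrier :=
  {x ∈ X.points | ∀ i, (s i).1 ∈ (E i).bundle.vanishing x}

/-- The incidence variety in `X × 𝐄`. -/
def incidence (E : Collection X k) : Set (X.carrier × E.Systems) :=
  {q | q.1 ∈ E.zeroSet q.2}

/-- The consistency variety `R_𝐄`: the Zariski closure of the projection of the incidence
variety to `𝐄`. -/
def consistencyVariety (E : Collection X k) : Set E.Systems :=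
  @closure _ (zariskiTopology E.Systems) (Prod.snd '' E.incidence)

/-- The generic system has no solution. -/
def GenericallyInconsistent (E : Collection X k) : Prop :=
  ∃ O : Set E.Systems, IsOpen[zariskiTopology E.Systems] O ∧ O.Nonempty ∧
    ∀ s ∈ O, E.zeroSet s = ∅

/-- `A` is a non-empty Zariski open subset of `R_𝐄`. -/
def IsGenericSubset (E : Collection X k) (A : Set E.Systems) : Prop :=
  A.Nonempty ∧ ∃ O : Set E.Systems, IsOpen[zariskiTopology E.Systems] O ∧
    A = E.consistencyVariety ∩ O

/-- Equivalence of collections: they have the same generic non-empty zero sets. -/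
def Equivalent {l : ℕ} (E : Collection X k) (W : Collection X l) : Prop :=
  ∃ (A : Set E.Systems) (B : Set W.Systems), E.IsGenericSubset A ∧ W.IsGenericSubset B ∧
    (∀ u ∈ A, ∃ v ∈ B, E.zeroSet u = W.zeroSet v) ∧
    (∀ v ∈ B, ∃ u ∈ A, E.zeroSet u = W.zeroSet v)

/-- The first `r` indices in `{1, …, k}`. -/
def initial (k r : ℕ) : Finset (Fin k) := Finset.univ.filter fun i => i.val < r

/-- The collection `E_J, …, E_J, E_{r+1}, …, E_k` with `m` copies of `E_J = E_1 ⋯ E_r`. -/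
def replaceInitial (E : Collection X k) (r m : ℕ) (hr : r ≤ k) : Collection X (m + (k - r)) :=
  Fin.append (fun _ => E.prodOn (initial k r)) fun i : Fin (k - r) => E ⟨r + i, by omega⟩

end Collection

end

/-! A general consistent system cuts out, through its equations in an essential `J`, exactly a fibre
of `Φ_J`. The same fibre is cut out by `τ_J + 1` general sections of `E_J` through one of its
points, so these can replace the equations in `J`.

Let `F` consist of all `E_i` and of `m = |J| - d + 1 = τ_J + 1` copies of `E_J` (`adjoinProd`). Both
collections are subfamilies of `F`. Over an affine chart with ring `A` there is a universal family:
a point `y` and, for every series in `F`, an arbitrary section corrected so as to vanish at `y`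
(`univSection`). Its parameter space is an affine space over the chart, and its image in the systems
of either subfamily is dense in the consistency variety (`mem_consistencyVariety_iff`). One
parameter `P` thus gives two systems, one for each collection, that vanish at the same `y` and share
the equations outside `J` and the copies. It suffices that the two zero sets agree for all `P` in
some non-empty open set: after shrinking, generic smoothness makes its two images relatively open
(`exists_isOpen_image`).

Call a set `T` of indices strict if `τ_T < τ_I + |T \ I|` for every proper subset `I`. For `J` this
is essentiality; for the copies it follows from `τ_J < m`. If `T` is strict, then the common zeros
of general sections through a general `y` are just the points with the same hyperplanes as `y`.
Otherwise let a second zero `x` agree with `y` exactly on `I`. The images of such pairs `(x, y)`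
move in dimension at most `2τ_T - τ_I`, and `x` imposes `|T \ I|` new conditions on the sections, so
a general choice would force `τ_I + |T \ I| ≤ τ_T`. This count is `algRank_add_card_sdiff_le`,
applied in `exists_generic_unique_zero`. By `hyperplane_prod_eq_iff` the fibres for `J` and for
`E_J` coincide, and `equivalent_ofFamily` concludes.

Dimensions are handled as transcendence degrees: `algRank_ratioSet` identifies `τ_E` with the
transcendence degree of the quotients of sections. The minimal defect of the new collection is
computed in `minDefect_adjoinProd`. -/

noncomputable section

/-! ### Transcendence degree as a matroid rank. -/

section AlgebraicRank

variable (k : Type*) [Field k]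

/-- The rank of a subset of a domain in the matroid of algebraic independence over `k`. -/
def algRank {L : Type*} [CommRing L] [IsDomain L] [Algebra k L] (S : Set L) : ℕ∞ :=
  (AlgebraicIndependent.matroid k L).eRk S

/-- The closure of a subset of a domain in the matroid of algebraic independence over `k`. -/
def algClosureOf {L : Type*} [CommRing L] [IsDomain L] [Algebra k L] (S : Set L) :
    Subalgebra k L :=
  (Subalgebra.algebraicClosure (Algebra.adjoin k S) L).restrictScalars k

variable {k} {L : Type*} [CommRing L] [IsDomain L] [Algebra k L]

theorem coe_algClosureOf (S : Set L) :
    (algClosureOf k S : Set L) = (AlgebraicIndependent.matroid k L).closure S := by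
  rw [AlgebraicIndependent.matroid_closure_eq]
  rfl

theorem mem_algClosureOf {S : Set L} {x : L} :
    x ∈ algClosureOf k S ↔ IsAlgebraic (Algebra.adjoin k S) x := Iff.rfl

theorem subset_algClosureOf (S : Set L) : S ⊆ algClosureOf k S := by
  rw [coe_algClosureOf]
  exact Matroid.subset_closure _ _ (Set.subset_univ _)

theorem algClosureOf_mono {S T : Set L} (h : S ⊆ T) : algClosureOf k S ≤ algClosureOf k T := by
  rw [← SetLike.coe_subset_coe, coe_algClosureOf, coe_algClosureOf]
  exact Matroid.closure_subset_closure _ h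

theorem algClosureOf_le {S T : Set L} (h : S ⊆ algClosureOf k T) :
    algClosureOf k S ≤ algClosureOf k T := by
  rw [coe_algClosureOf] at h
  rw [← SetLike.coe_subset_coe, coe_algClosureOf, coe_algClosureOf]
  exact Matroid.closure_subset_closure_of_subset_closure h

theorem inv_mem_algClosureOf {L : Type*} [Field L] [Algebra k L] {S : Set L} {x : L}
    (h : x ∈ algClosureOf k S) : x⁻¹ ∈ algClosureOf k S := by
  rw [mem_algClosureOf] at *
  exact h.inv

theorem div_mem_algClosureOf {L : Type*} [Field L] [Algebra k L] {S : Set L} {x y : L}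
    (hx : x ∈ algClosureOf k S) (hy : y ∈ algClosureOf k S) : x / y ∈ algClosureOf k S := by
  rw [div_eq_mul_inv]
  exact mul_mem hx (inv_mem_algClosureOf hy)

theorem algRank_closure (S : Set L) : algRank k (algClosureOf k S : Set L) = algRank k S := by
  rw [coe_algClosureOf]
  exact Matroid.eRk_closure_eq _ _

theorem algRank_mono {S T : Set L} (h : S ⊆ T) : algRank k S ≤ algRank k T :=
  Matroid.eRk_mono _ h

theorem algRank_le_of_subset_closure {S T : Set L} (h : S ⊆ algClosureOf k T) :
    algRank k S ≤ algRank k T := by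
  rw [← algRank_closure T]
  exact algRank_mono h

theorem algRank_eq_of_closure_eq {S T : Set L} (h : algClosureOf k S = algClosureOf k T) :
    algRank k S = algRank k T := by
  rw [← algRank_closure T, ← h, algRank_closure]

theorem algRank_le_encard (S : Set L) : algRank k S ≤ S.encard :=
  Matroid.eRk_le_encard _ _

theorem algRank_union_le (S T : Set L) : algRank k (S ∪ T) ≤ algRank k S + T.encard :=
  Matroid.eRk_union_le_eRk_add_encard _ _ _

/-- Submodularity of the rank, for sets with a common part up to closure. -/
theorem algRank_submod {S T U : Set L} (hS : U ⊆ algClosureOf k S) (hT : U ⊆ algClosureOf k T) :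
    algRank k U + algRank k (S ∪ T) ≤ algRank k S + algRank k T := by
  have h := (AlgebraicIndependent.matroid k L).eRk_submod (algClosureOf k S : Set L)
    (algClosureOf k T : Set L)
  rw [← algRank_closure S, ← algRank_closure T]
  refine le_trans (add_le_add ?_ ?_) h
  · exact Matroid.eRk_mono _ (Set.subset_inter hS hT)
  · exact Matroid.eRk_mono _ (Set.union_subset_union (subset_algClosureOf S)
      (subset_algClosureOf T))

theorem exists_algebraicIndependent_encard_eq (S : Set L) :
    ∃ I ⊆ S, AlgebraicIndependent k ((↑) : I → L) ∧ I.encard = algRank k S := by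
  obtain ⟨I, hI⟩ := (AlgebraicIndependent.matroid k L).exists_isBasis S (Set.subset_univ _)
  exact ⟨I, hI.subset, hI.indep, hI.encard_eq_eRk⟩

theorem encard_le_algRank {S I : Set L} (h : I ⊆ S)
    (hI : AlgebraicIndependent k ((↑) : I → L)) : I.encard ≤ algRank k S := by
  have : (AlgebraicIndependent.matroid k L).Indep I := hI
  rw [← this.eRk_eq_encard]
  exact Matroid.eRk_mono _ h

theorem enatCard_le_algRank {ι : Type*} {v : ι → L} {S : Set L} (hv : AlgebraicIndependent k v)
    (h : ∀ i, v i ∈ S) : ENat.card ι ≤ algRank k S := by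
  refine le_trans (le_of_eq ?_) (encard_le_algRank (Set.range_subset_iff.2 h) hv.coe_range)
  have h2 := hv.injective.injOn.encard_image (s := Set.univ)
  rw [Set.image_univ, Set.encard_univ] at h2
  exact h2.symm

section Map

variable {L' : Type*} [CommRing L'] [IsDomain L'] [Algebra k L']

/-- Preimages of algebraically independent elements are algebraically independent. -/
theorem algRank_image_le (f : L →ₐ[k] L') (S : Set L) : algRank k (f '' S) ≤ algRank k S := by
  obtain ⟨I, hIS, hI, hcard⟩ := exists_algebraicIndependent_encard_eq (k := k) (f '' S)
  choose g hg using fun i : I => hIS i.2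
  have hind : AlgebraicIndependent k g := by
    refine AlgebraicIndependent.of_comp f ?_
    convert hI using 1
    ext i
    exact (hg i).2
  rw [← hcard]
  exact enatCard_le_algRank hind fun i => (hg i).1

theorem algRank_image (f : L →ₐ[k] L') (hf : Function.Injective f) (S : Set L) :
    algRank k (f '' S) = algRank k S := by
  refine (algRank_image_le f S).antisymm ?_
  obtain ⟨I, hIS, hI, hcard⟩ := exists_algebraicIndependent_encard_eq (k := k) S
  rw [← hcard]
  exact enatCard_le_algRank (hI.map' hf) fun i => ⟨i, hIS i.2, rfl⟩

end Map

/-- Adjoining variables to a domain adds their number to the rank. -/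
theorem algRank_add_encard_le {σ : Type*} (S : Set L) (T : Set σ)
    {L' : Type*} [CommRing L'] [IsDomain L'] [Algebra k L']
    (f : MvPolynomial σ L →ₐ[k] L') (hf : Function.Injective f) :
    algRank k S + T.encard ≤
      algRank k ((fun x => f (MvPolynomial.C x)) '' S ∪ (fun t => f (MvPolynomial.X t)) '' T) := by
  obtain ⟨I, hIS, hI, hcard⟩ := exists_algebraicIndependent_encard_eq (k := k) S
  have h1 : AlgebraicIndependent L fun t : T => (MvPolynomial.X t.1 : MvPolynomial σ L) :=
    (MvPolynomial.algebraicIndependent_X σ L).comp _ Subtype.val_injective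
  have h2 := (hI.sumElim_comp h1).map' hf
  rw [← hcard]
  have h3 := enatCard_le_algRank (S := (fun x => f (MvPolynomial.C x)) '' S ∪
    (fun t => f (MvPolynomial.X t)) '' T) h2 ?_
  · refine le_trans (le_of_eq ?_) h3
    rw [ENat.card_sum, add_comm]
    rfl
  · rintro (t | i)
    · exact Or.inr ⟨t, t.2, rfl⟩
    · exact Or.inl ⟨i, hIS i.2, rfl⟩

end AlgebraicRank

/-! ### Krull dimension of a finitely generated domain. -/

section Dimension

variable (k : Type*) [Field k] {R : Type*} [CommRing R] [IsDomain R] [Algebra k R]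

/-- The dimension of a finitely generated domain is the rank of any set that generates it up to
algebraic elements. -/
theorem ringKrullDim_eq_algRank [Algebra.FiniteType k R] {S : Set R}
    (hS : algClosureOf k S = ⊤) : ringKrullDim R = (algRank k S : WithBot ℕ∞) := by
  -- Noether normalization: both sides turn out to be the number `s` of variables.
  obtain ⟨s, g, hinj, hint⟩ := exists_integral_inj_algHom_of_fg k R
  let : Algebra (MvPolynomial (Fin s) k) R := g.toRingHom.toAlgebra
  have : Algebra.IsIntegral (MvPolynomial (Fin s) k) R := ⟨hint⟩
  have hrank : algRank k S = s := by
    have hind : AlgebraicIndependent k fun i : Fin s => g (MvPolynomial.X i) :=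
      (MvPolynomial.algebraicIndependent_X (Fin s) k).map' hinj
    have hcl : algClosureOf k (Set.range fun i : Fin s => g (MvPolynomial.X i)) = ⊤ := by
      rw [eq_top_iff]
      intro x _
      rw [mem_algClosureOf]
      have hx : IsAlgebraic (MvPolynomial (Fin s) k) x :=
        (Algebra.IsIntegral.isIntegral (R := MvPolynomial (Fin s) k) x).isAlgebraic
      have hmem : ∀ p, g p ∈ Algebra.adjoin k (Set.range fun i : Fin s => g (MvPolynomial.X i)) := by
        intro p
        rw [Algebra.adjoin_range_eq_range_aeval]
        refine ⟨p, ?_⟩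
        change (MvPolynomial.aeval fun i => g (MvPolynomial.X i)) p = g p
        refine DFunLike.congr_fun (MvPolynomial.algHom_ext fun i => ?_) p
        rw [MvPolynomial.aeval_X]
      obtain ⟨p, hp, hpx⟩ := hx
      let φ : MvPolynomial (Fin s) k →+* Algebra.adjoin k
        (Set.range fun i : Fin s => g (MvPolynomial.X i)) :=
          g.toRingHom.codRestrict (Algebra.adjoin k
        (Set.range fun i : Fin s => g (MvPolynomial.X i))).toSubring hmem
      refine ⟨p.map φ, ?_, ?_⟩
      · refine (Polynomial.map_ne_zero_iff ?_).2 hp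
        intro a b hab
        exact hinj (congrArg Subtype.val hab)
      · rw [Polynomial.aeval_def, Polynomial.eval₂_map]
        rw [Polynomial.aeval_def] at hpx
        exact hpx
    have h1 : (Set.range fun i : Fin s => g (MvPolynomial.X i)).encard = s := by
      rw [← Set.image_univ, hind.injective.injOn.encard_image, Set.encard_univ]
      simp
    rw [algRank_eq_of_closure_eq (hS.trans hcl.symm)]
    refine le_antisymm ((algRank_le_encard _).trans h1.le) ?_
    rw [← h1]
    exact encard_le_algRank le_rfl hind.coe_range
  have hdim : ringKrullDim (MvPolynomial (Fin s) k) = s := by simp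
  rw [hrank]
  -- Incomparability keeps contracted chains of primes strict; lying over and going up lift chains
  -- to `R`.
  refine le_antisymm ?_ ?_
  · refine le_trans ?_ hdim.le
    refine Order.krullDim_le_of_strictMono
      (PrimeSpectrum.comap (algebraMap (MvPolynomial (Fin s) k) R)) fun p q hpq => ?_
    exact Ideal.IsIntegral.comap_lt_comap (I := p.asIdeal) (J := q.asIdeal) hpq
  · refine le_trans hdim.ge ?_
    refine iSup_le fun l => ?_
    have hsurj : Function.Surjective
        (PrimeSpectrum.comap (algebraMap (MvPolynomial (Fin s) k) R)) :=
      hint.comap_surjective hinj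
    obtain ⟨P, hP⟩ := hsurj l.head
    have : P.asIdeal.LiesOver l.head.asIdeal := ⟨by rw [← hP]; rfl⟩
    obtain ⟨L, hL, -⟩ := Ideal.exists_ltSeries_of_hasGoingUp l P.asIdeal
    rw [← hL]
    exact Order.LTSeries.length_le_krullDim L

end Dimension

end

/-! ### Closed points of affine varieties, and openness of dominant maps. -/

noncomputable section

section ClosedPoints

/-- The closed points of the spectrum of a complex algebra of finite type. -/
def ClosedPt (B : Type*) [CommRing B] [Algebra ℂ B] := B →ₐ[ℂ] ℂ

namespace ClosedPt

variable {B : Type*} [CommRing B] [Algebra ℂ B]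

instance : FunLike (ClosedPt B) B ℂ := inferInstanceAs (FunLike (B →ₐ[ℂ] ℂ) B ℂ)
instance : AlgHomClass (ClosedPt B) ℂ B ℂ := inferInstanceAs (AlgHomClass (B →ₐ[ℂ] ℂ) ℂ B ℂ)

@[ext]
theorem ext {P Q : ClosedPt B} (h : ∀ b, P b = Q b) : P = Q := AlgHom.ext h

/-- The maximal ideal of a closed point. -/
def toSpec (P : ClosedPt B) : PrimeSpectrum B := ⟨RingHom.ker P, RingHom.ker_isPrime P⟩

theorem mem_toSpec {P : ClosedPt B} {b : B} : b ∈ P.toSpec.asIdeal ↔ P b = 0 := Iff.rfl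

instance : TopologicalSpace (ClosedPt B) := induced toSpec inferInstance

theorem isInducing_toSpec : Topology.IsInducing (toSpec : ClosedPt B → PrimeSpectrum B) := ⟨rfl⟩

theorem isOpen_iff {O : Set (ClosedPt B)} :
    IsOpen O ↔ ∃ G : Set B, O = {P | ∃ g ∈ G, P g ≠ 0} := by
  rw [isInducing_toSpec.isOpen_iff]
  constructor
  · rintro ⟨t, ht, rfl⟩
    obtain ⟨G, hG⟩ := (PrimeSpectrum.isOpen_iff t).1 ht
    refine ⟨G, ?_⟩
    ext P
    rw [← compl_compl t, hG]
    simp [PrimeSpectrum.mem_zeroLocus, Set.not_subset, mem_toSpec]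
  · rintro ⟨G, rfl⟩
    refine ⟨(PrimeSpectrum.zeroLocus G)ᶜ, (PrimeSpectrum.isClosed_zeroLocus G).isOpen_compl, ?_⟩
    ext P
    simp [PrimeSpectrum.mem_zeroLocus, Set.not_subset, mem_toSpec]

theorem isOpen_ne (g : B) : IsOpen {P : ClosedPt B | P g ≠ 0} :=
  isOpen_iff.2 ⟨{g}, by simp⟩

/-- The map of closed points induced by a homomorphism. -/
def comap {A : Type*} [CommRing A] [Algebra ℂ A] (f : A →ₐ[ℂ] B) (P : ClosedPt B) : ClosedPt A :=
  AlgHom.comp (P : B →ₐ[ℂ] ℂ) f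

@[simp]
theorem comap_apply {A : Type*} [CommRing A] [Algebra ℂ A] (f : A →ₐ[ℂ] B) (P : ClosedPt B)
    (a : A) : comap f P a = P (f a) := rfl

theorem continuous_comap {A : Type*} [CommRing A] [Algebra ℂ A] (f : A →ₐ[ℂ] B) :
    Continuous (comap f) := by
  rw [continuous_def]
  intro s hs
  obtain ⟨G, rfl⟩ := isOpen_iff.1 hs
  exact isOpen_iff.2 ⟨f '' G, by ext P; simp⟩

/-- The element `b - P b` always lies in the kernel of `P`, so one inclusion of kernels suffices. -/
theorem eq_of_ker_le {P Q : ClosedPt B} (h : ∀ b, P b = 0 → Q b = 0) : P = Q := by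
  ext b
  have h1 := h (b - algebraMap ℂ B (P b)) (by
    rw [map_sub, AlgHomClass.commutes, Algebra.algebraMap_self, RingHom.id_apply, sub_self])
  rw [map_sub, sub_eq_zero, AlgHomClass.commutes] at h1
  exact h1.symm

theorem exists_comap_eq {A : Type*} [CommRing A] [Algebra ℂ A] (ρ : A →ₐ[ℂ] B)
    (hρ : Function.Surjective ρ) {u : ClosedPt A} (hu : ∀ f, ρ f = 0 → u f = 0) :
    ∃ v : ClosedPt B, comap ρ v = u := by
  refine ⟨(Ideal.Quotient.liftₐ (RingHom.ker ρ) (u : A →ₐ[ℂ] ℂ) hu).comp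
    (Ideal.quotientKerAlgEquivOfSurjective hρ).symm.toAlgHom, ClosedPt.ext fun s => ?_⟩
  have : (Ideal.quotientKerAlgEquivOfSurjective hρ).symm (ρ s) =
      Ideal.Quotient.mk (RingHom.ker ρ) s := by
    rw [AlgEquiv.symm_apply_eq]
    rfl
  change Ideal.Quotient.liftₐ (RingHom.ker ρ) (u : A →ₐ[ℂ] ℂ) hu
    ((Ideal.quotientKerAlgEquivOfSurjective hρ).symm (ρ s)) = u s
  rw [this]
  rfl

/-- Zariski's lemma: the residue field at a maximal ideal is finite over `ℂ`, hence equal to it. -/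
theorem exists_of_nontrivial (B : Type*) [CommRing B] [Algebra ℂ B] [Algebra.FiniteType ℂ B]
    [Nontrivial B] : Nonempty (ClosedPt B) := by
  obtain ⟨M, hM⟩ := Ideal.exists_maximal B
  let _ : Field (B ⧸ M) := Ideal.Quotient.field M
  have : Module.Finite ℂ (B ⧸ M) := finite_of_finite_type_of_isJacobsonRing ℂ (B ⧸ M)
  have h := IsAlgClosed.algebraMap_bijective_of_isIntegral (k := ℂ) (K := B ⧸ M)
  exact ⟨(((AlgEquiv.ofBijective (Algebra.ofId ℂ (B ⧸ M)) h).symm :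
    (B ⧸ M) →ₐ[ℂ] ℂ).comp (Ideal.Quotient.mkₐ ℂ M) : B →ₐ[ℂ] ℂ)⟩

/-- The Nullstellensatz: a function that does not lie in a prime ideal is nonzero at some closed
point of the corresponding subvariety. -/
theorem exists_ne_zero [Algebra.FiniteType ℂ B] (p : Ideal B) [p.IsPrime] {g : B} (hg : g ∉ p) :
    ∃ P : ClosedPt B, (∀ b ∈ p, P b = 0) ∧ P g ≠ 0 := by
  let g' : B ⧸ p := Ideal.Quotient.mk p g
  have hg' : g' ≠ 0 := fun h => hg (Ideal.Quotient.eq_zero_iff_mem.1 h)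
  -- Rabinowitsch trick: any closed point after inverting `g` will do.
  let T := Localization.Away g'
  have : IsDomain T := IsLocalization.isDomain_of_le_nonZeroDivisors (R := B ⧸ p) (M := .powers g') T
    (powers_le_nonZeroDivisors_of_noZeroDivisors hg')
  have : Algebra.FiniteType (B ⧸ p) T := IsLocalization.finiteType_of_monoid_fg
    (Submonoid.powers g') T
  have : Algebra.FiniteType ℂ T := Algebra.FiniteType.trans (S := B ⧸ p) inferInstance this
  obtain ⟨Q⟩ := exists_of_nontrivial T
  refine ⟨comap ((IsScalarTower.toAlgHom ℂ (B ⧸ p) T).comp (Ideal.Quotient.mkₐ ℂ p)) Q, ?_, ?_⟩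
  · intro b hb
    have : Ideal.Quotient.mk p b = 0 := Ideal.Quotient.eq_zero_iff_mem.2 hb
    simp [this]
  · have hu : IsUnit (algebraMap (B ⧸ p) T g') := IsLocalization.Away.algebraMap_isUnit g'
    have := (hu.map Q).ne_zero
    simpa using this

theorem exists_apply_ne_zero [Algebra.FiniteType ℂ B] [IsDomain B] {g : B} (hg : g ≠ 0) :
    ∃ P : ClosedPt B, P g ≠ 0 := by
  obtain ⟨P, -, h⟩ := exists_ne_zero (⊥ : Ideal B) (g := g) (by simpa using hg)
  exact ⟨P, h⟩

end ClosedPt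

/-- Generic smoothness. -/
theorem exists_smooth_away (S B : Type*) [CommRing S] [CommRing B] [IsDomain S] [IsDomain B]
    [CharZero S] [IsNoetherianRing S] [Algebra S B] [Algebra.FiniteType S B]
    (hinj : Function.Injective (algebraMap S B)) :
    ∃ h : B, h ≠ 0 ∧ Algebra.Smooth S (Localization.Away h) := by
  have : Algebra.FinitePresentation S B := Algebra.FinitePresentation.of_finiteType.1 inferInstance
  have : FaithfulSMul S B := (faithfulSMul_iff_algebraMap_injective S B).2 hinj
  let K := FractionRing S
  let F := FractionRing B
  let _ : Algebra K F := FractionRing.liftAlgebra S F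
  have : IsScalarTower S K F := FractionRing.isScalarTower_liftAlgebra S F
  have : CharZero K := charZero_of_injective_algebraMap (IsFractionRing.injective S K)
  have : Algebra.EssFiniteType B F := Algebra.EssFiniteType.of_isLocalization _ (nonZeroDivisors B)
  have : Algebra.EssFiniteType S F := Algebra.EssFiniteType.comp S B F
  have : Algebra.EssFiniteType K F := Algebra.EssFiniteType.of_comp S K F
  -- In characteristic zero the extension of fraction fields is formally smooth. So the generic
  -- point lies in the smooth locus, which is open.
  have h1 : Algebra.FormallySmooth K F := Algebra.FormallySmooth.of_perfectField
  have h2 : Algebra.FormallySmooth S K := Algebra.FormallySmooth.of_isLocalization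
    (nonZeroDivisors S)
  have h3 : Algebra.FormallySmooth S F := Algebra.FormallySmooth.comp S K F
  let η : PrimeSpectrum B := ⟨⊥, Ideal.isPrime_bot⟩
  have hη : η ∈ Algebra.smoothLocus S B := by
    change Algebra.FormallySmooth S (Localization.AtPrime (⊥ : Ideal B))
    have : IsLocalization (nonZeroDivisors B) (Localization.AtPrime (⊥ : Ideal B)) := by
      convert Localization.isLocalization (M := (⊥ : Ideal B).primeCompl)
      ext x
      simp [Ideal.primeCompl]
    exact Algebra.FormallySmooth.of_equiv ((IsLocalization.algEquiv (nonZeroDivisors B) F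
      (Localization.AtPrime (⊥ : Ideal B))).restrictScalars S)
  obtain ⟨_, ⟨_, ⟨h, rfl⟩, rfl⟩, hh, hle⟩ :=
    PrimeSpectrum.isBasis_basic_opens.exists_subset_of_mem_open hη
      (Algebra.isOpen_smoothLocus (R := S) (A := B))
  refine ⟨h, ?_, Algebra.basicOpen_subset_smoothLocus_iff_smooth.1 hle⟩
  intro h0
  exact hh (by simp [h0, η])

/-- A dominant morphism of varieties is open on a non-empty open subset. -/
theorem exists_isOpen_image_of_algebra {S R B : Type*} [CommRing S] [CommRing R] [CommRing B]
    [IsDomain R] [IsDomain B] [Algebra ℂ S] [Algebra ℂ R] [Algebra ℂ B] [Algebra R B]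
    [IsScalarTower ℂ R B] [Algebra.FiniteType ℂ S] [Algebra.FiniteType ℂ B]
    (ρ : S →ₐ[ℂ] R) (hρ : Function.Surjective ρ) (hinj : Function.Injective (algebraMap R B)) :
    ∃ h : B, h ≠ 0 ∧ ∀ O : Set (ClosedPt B), IsOpen O → ∃ O' : Set (ClosedPt S), IsOpen O' ∧
      (fun P => ClosedPt.comap ρ (ClosedPt.comap (IsScalarTower.toAlgHom ℂ R B) P)) ''
        (O ∩ {P | P h ≠ 0}) = {u | ∀ f, ρ f = 0 → u f = 0} ∩ O' := by
  have : Algebra.FiniteType ℂ R := Algebra.FiniteType.of_surjective ρ hρ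
  have : IsNoetherianRing R := Algebra.FiniteType.isNoetherianRing ℂ R
  have : CharZero R := charZero_of_injective_algebraMap (algebraMap ℂ R).injective
  have : Algebra.FiniteType R B := Algebra.FiniteType.of_restrictScalars_finiteType ℂ R B
  obtain ⟨h, h0, hsm⟩ := exists_smooth_away R B hinj
  -- Smooth implies flat, and flat of finite presentation implies open on spectra. The rest carries
  -- this over to closed points.
  let T := Localization.Away h
  have : Module.Flat R T := hsm.flat
  have hopen : IsOpenMap (PrimeSpectrum.comap (algebraMap R T)) :=
    PrimeSpectrum.isOpenMap_comap_of_hasGoingDown_of_finitePresentation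
  refine ⟨h, h0, fun O hO => ?_⟩
  obtain ⟨G, rfl⟩ := ClosedPt.isOpen_iff.1 hO
  let W := PrimeSpectrum.comap (algebraMap R T) ''
    (PrimeSpectrum.zeroLocus (algebraMap B T '' G))ᶜ
  have hW : IsOpen W := hopen _ (PrimeSpectrum.isClosed_zeroLocus _).isOpen_compl
  obtain ⟨W', hW', hWW⟩ := (PrimeSpectrum.isClosedEmbedding_comap_of_surjective _ ρ.toRingHom
    hρ).isInducing.isOpen_iff.1 hW
  refine ⟨ClosedPt.toSpec ⁻¹' W', hW'.preimage ClosedPt.isInducing_toSpec.continuous, ?_⟩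
  have key : ∀ (u : ClosedPt S) (v : ClosedPt R), ClosedPt.comap ρ v = u →
      (u.toSpec ∈ W' ↔ v.toSpec ∈ W) := by
    rintro _ v rfl
    rw [← hWW]
    rfl
  ext u
  constructor
  · rintro ⟨P, ⟨⟨g, hg, hPg⟩, hPh⟩, rfl⟩
    refine ⟨fun f hf => by simp [hf], ?_⟩
    refine (key _ (ClosedPt.comap (IsScalarTower.toAlgHom ℂ R B) P) rfl).2 ?_
    let P' : T →+* ℂ := IsLocalization.Away.lift h (g := (P : B →ₐ[ℂ] ℂ).toRingHom)
      (IsUnit.mk0 _ hPh)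
    have hP' : ∀ b, P' (algebraMap B T b) = P b := fun b => IsLocalization.Away.lift_eq h _ b
    refine ⟨⟨RingHom.ker P', RingHom.ker_isPrime P'⟩, ?_, ?_⟩
    · rw [Set.mem_compl_iff, PrimeSpectrum.mem_zeroLocus, Set.not_subset]
      refine ⟨_, ⟨g, hg, rfl⟩, fun hc => hPg ?_⟩
      rw [← hP']
      exact hc
    · ext r
      change P' (algebraMap R T r) = 0 ↔ P (algebraMap R B r) = 0
      rw [IsScalarTower.algebraMap_apply R B T, hP']
  · rintro ⟨hu, huW⟩
    obtain ⟨v, hv⟩ := ClosedPt.exists_comap_eq ρ hρ hu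
    rw [Set.mem_preimage, key u v hv] at huW
    obtain ⟨p, hp, hpv⟩ := huW
    rw [Set.mem_compl_iff, PrimeSpectrum.mem_zeroLocus, Set.not_subset] at hp
    obtain ⟨_, ⟨g, hg, rfl⟩, hgp⟩ := hp
    have hhp : algebraMap B T h ∉ p.asIdeal := fun hc => p.2.ne_top
      (Ideal.eq_top_of_isUnit_mem _ hc (IsLocalization.Away.algebraMap_isUnit h))
    -- The prime `p` over `v` need not be maximal. A closed point in its closure, chosen where `g *
    -- h` does not vanish, still lies over `v` because the kernel of `v` is maximal.
    obtain ⟨P, hP, hP2⟩ := ClosedPt.exists_ne_zero (p.asIdeal.comap (algebraMap B T))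
      (g := g * h) (by
        rw [Ideal.mem_comap, map_mul]
        exact fun hc => (p.2.mem_or_mem hc).elim hgp hhp)
    rw [map_mul] at hP2
    refine ⟨P, ⟨⟨g, hg, left_ne_zero_of_mul hP2⟩, right_ne_zero_of_mul hP2⟩, ?_⟩
    rw [← hv]
    have : v = ClosedPt.comap (IsScalarTower.toAlgHom ℂ R B) P := by
      refine ClosedPt.eq_of_ker_le fun r hr => hP _ ?_
      have : r ∈ v.toSpec.asIdeal := hr
      rw [← hpv] at this
      exact this
    rw [this]

/-- A morphism of varieties is open onto the closure of its image on a non-empty open subset. -/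
theorem exists_isOpen_image {S B : Type*} [CommRing S] [CommRing B] [IsDomain B]
    [Algebra ℂ S] [Algebra ℂ B] [Algebra.FiniteType ℂ S] [Algebra.FiniteType ℂ B]
    (π : S →ₐ[ℂ] B) :
    ∃ h : B, h ≠ 0 ∧ ∀ O : Set (ClosedPt B), IsOpen O → ∃ O' : Set (ClosedPt S), IsOpen O' ∧
      ClosedPt.comap π '' (O ∩ {P | P h ≠ 0}) = {u | ∀ f, π f = 0 → u f = 0} ∩ O' := by
  obtain ⟨h, h0, H⟩ := exists_isOpen_image_of_algebra π.rangeRestrict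
    π.rangeRestrict_surjective (B := B) Subtype.val_injective
  refine ⟨h, h0, fun O hO => ?_⟩
  obtain ⟨O', hO', hE⟩ := H O hO
  refine ⟨O', hO', ?_⟩
  have : {u : ClosedPt S | ∀ f, π f = 0 → u f = 0} =
      {u | ∀ f, π.rangeRestrict f = 0 → u f = 0} := by
    ext u
    exact forall_congr' fun f => imp_congr_left
      ⟨fun h => Subtype.ext h, fun h => congrArg Subtype.val h⟩
  rw [this, ← hE]
  rfl

/-- Closed points of a dense open subset lift along a dominant morphism. -/
theorem exists_lift_closedPt {S B : Type*} [CommRing S] [CommRing B] [IsDomain B]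
    [Algebra ℂ S] [Algebra ℂ B] [Algebra.FiniteType ℂ S] [Algebra.FiniteType ℂ B]
    (π : S →ₐ[ℂ] B) (hπ : Function.Injective π) :
    ∃ h : S, h ≠ 0 ∧ ∀ u : ClosedPt S, u h ≠ 0 → ∃ P : ClosedPt B, ClosedPt.comap π P = u := by
  obtain ⟨h, h0, H⟩ := exists_isOpen_image π
  obtain ⟨O', hO', hE⟩ := H Set.univ isOpen_univ
  obtain ⟨P, hP⟩ := ClosedPt.exists_apply_ne_zero h0
  obtain ⟨G, rfl⟩ := ClosedPt.isOpen_iff.1 hO'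
  obtain ⟨-, g, hg, hPg⟩ := hE.le ⟨P, ⟨trivial, hP⟩, rfl⟩
  refine ⟨g, fun h => hPg (by simp [h]), fun u hu => ?_⟩
  obtain ⟨Q, -, hQ⟩ := hE.ge ⟨fun f hf => by
    rw [(map_eq_zero_iff π hπ).1 hf, map_zero], g, hg, hu⟩
  exact ⟨Q, hQ⟩

end ClosedPoints

end

/-! ### The universal section through a point, and the dimension count for a second zero. -/

noncomputable section

section UniversalSection

open MvPolynomial

variable {ι : Type*} {N : ι → Type*} [∀ i, Fintype (N i)] [∀ i, DecidableEq (N i)]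
  {A : Type*} [CommRing A]

/-- The coordinates of the universal family of sections that vanish at the universal point, if the
`i`-th linear series is spanned by the functions `a i j` and `a i (j₀ i) = 1`. -/
def univSection (a : ∀ i, N i → A) (j₀ : ∀ i, N i) (p : Σ i, N i) :
    MvPolynomial (Σ i, N i) A :=
  X p - if p.2 = j₀ p.1 then ∑ l, C (a p.1 l) * X ⟨p.1, l⟩ else 0

variable {a : ∀ i, N i → A} {j₀ : ∀ i, N i}

/-- Vanishing at a second point `b` becomes a linear equation in the coordinates, whose coefficients
measure how far `b i` is from being proportional to `a i`. If `a i (j₀ i) = 1`, the coefficient at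
`j₀ i` is zero and only the free coordinates enter. -/
theorem sum_mul_univSection {B : Type*} [CommRing B] (ψ : MvPolynomial (Σ i, N i) A →+* B)
    (i : ι) (b : N i → B) :
    ∑ j, b j * ψ (univSection a j₀ ⟨i, j⟩) =
      ∑ j, (b j - b (j₀ i) * ψ (C (a i j))) * ψ (X ⟨i, j⟩) := by
  simp only [univSection, map_sub, mul_sub, Finset.sum_sub_distrib, sub_mul]
  congr 1
  rw [Finset.sum_eq_single (j₀ i)]
  · simp [map_sum, Finset.mul_sum, mul_assoc]
  · intro j _ hj
    simp [hj]
  · simp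

theorem sum_C_mul_univSection {i : ι} (h : a i (j₀ i) = 1) :
    ∑ j, C (a i j) * univSection a j₀ ⟨i, j⟩ = 0 := by
  have := sum_mul_univSection (a := a) (j₀ := j₀) (RingHom.id _) i fun j => C (a i j)
  simpa [h] using this

/-- The dimension count for a second common zero of the generic sections that vanish at the generic
point. -/
theorem algRank_add_card_sdiff_le {ι : Type*} [DecidableEq ι] {N : ι → Type*} [∀ i, Fintype (N i)]
    [∀ i, DecidableEq (N i)] {A : Type*} [CommRing A] {a : ∀ i, N i → A} {j₀ : ∀ i, N i}
    [IsDomain A] [Algebra ℂ A] (ha : ∀ i, a i (j₀ i) = 1)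
    {L : Type*} [Field L] [Algebra ℂ L] (ψ : MvPolynomial (Σ i, N i) A →ₐ[ℂ] L)
    (hψ : Function.Injective ψ) {I J : Finset ι} (hIJ : I ⊆ J) {b : ∀ i, N i → L} {j₁ : ∀ i, N i}
    (hb : ∀ i, b i (j₁ i) = 1)
    (hrank : algRank ℂ (⋃ i ∈ J, Set.range (b i)) ≤ algRank ℂ (⋃ i ∈ J, Set.range (a i)))
    (hI : ∀ i ∈ I, ∀ j, b i j = b i (j₀ i) * ψ (C (a i j)))
    (hne : ∀ i ∈ J \ I, ∃ j, b i j ≠ b i (j₀ i) * ψ (C (a i j)))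
    (hs : ∀ i ∈ J, ∑ j, b i j * ψ (univSection a j₀ ⟨i, j⟩) = 0) :
    algRank ℂ (⋃ i ∈ I, Set.range (a i)) + (J \ I).card ≤
      algRank ℂ (⋃ i ∈ J, Set.range (a i)) := by
  have : ∀ i, Nonempty (N i) := fun i => ⟨j₀ i⟩
  choose! jj hjj using hne
  have hjj0 : ∀ i ∈ J \ I, jj i ≠ j₀ i := by
    intro i hi h
    refine hjj i hi ?_
    rw [h, ha, C_1, map_one, mul_one]
  -- `T₀` collects the free coordinates of the sections in `J`. For `i ∉ I` the set `T₁` also omits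
  -- `jj i`, the coordinate that vanishing at the second point determines.
  let T₀ : Finset (Σ i, N i) := J.sigma fun i => Finset.univ.erase (j₀ i)
  let T₁ : Finset (Σ i, N i) := J.sigma fun i =>
    if i ∈ I then Finset.univ.erase (j₀ i) else (Finset.univ.erase (j₀ i)).erase (jj i)
  have hcard : T₀.card = T₁.card + (J \ I).card := by
    simp only [T₀, T₁, Finset.card_sigma]
    rw [Finset.card_eq_sum_ones, ← Finset.sum_sdiff hIJ, ← Finset.sum_sdiff hIJ, add_right_comm,
      ← Finset.sum_add_distrib]
    congr 1
    · refine Finset.sum_congr rfl fun i hi => ?_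
      rw [if_neg (Finset.mem_sdiff.1 hi).2,
        Finset.card_erase_add_one (Finset.mem_erase.2 ⟨hjj0 i hi, Finset.mem_univ _⟩)]
    · refine Finset.sum_congr rfl fun i hi => ?_
      rw [if_pos hi]
  let ψC : A →ₐ[ℂ] L := ψ.comp (IsScalarTower.toAlgHom ℂ A (MvPolynomial (Σ i, N i) A))
  have hψC : ∀ x, ψC x = ψ (C x) := fun x => rfl
  have hψCinj : Function.Injective ψC := hψ.comp (C_injective _ _)
  let α : Finset ι → Set L := fun I => ⋃ i ∈ I, Set.range fun j => ψ (C (a i j))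
  let β : Set L := ⋃ i ∈ J, Set.range (b i)
  have hα : ∀ I, α I = ψC '' ⋃ i ∈ I, Set.range (a i) := by
    intro I
    simp only [α, Set.image_iUnion, ← Set.range_comp]
    rfl
  have hαrank : ∀ I, algRank ℂ (α I) = algRank ℂ (⋃ i ∈ I, Set.range (a i)) := by
    intro I
    rw [hα, algRank_image _ hψCinj]
  have hmemα : ∀ {I : Finset ι} {i : ι}, i ∈ I → ∀ j, ψ (C (a i j)) ∈ α I := fun hi j =>
    Set.mem_iUnion₂.2 ⟨_, hi, j, rfl⟩
  have hmemβ : ∀ {i : ι}, i ∈ J → ∀ j, b i j ∈ β := fun hi j =>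
    Set.mem_iUnion₂.2 ⟨_, hi, j, rfl⟩
  have h1 : algRank ℂ (α J) + T₀.card ≤
      algRank ℂ (α J ∪ (fun t => ψ (X t)) '' (T₀ : Set (Σ i, N i))) := by
    have := algRank_add_encard_le (k := ℂ) (⋃ i ∈ J, Set.range (a i)) (T₀ : Set (Σ i, N i)) ψ hψ
    rw [Set.encard_coe_eq_coe_finsetCard, ← hαrank] at this
    convert this using 3
    exact hα J
  have h2 : algRank ℂ (α J ∪ (fun t => ψ (X t)) '' (T₀ : Set (Σ i, N i))) ≤
      algRank ℂ (α J ∪ β ∪ (fun t => ψ (X t)) '' (T₁ : Set (Σ i, N i))) := by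
    set Γ := algClosureOf ℂ (α J ∪ β ∪ (fun t => ψ (X t)) '' (T₁ : Set (Σ i, N i))) with hΓ
    have hαΓ : ∀ {i : ι}, i ∈ J → ∀ j, ψ (C (a i j)) ∈ Γ := fun hi j =>
      subset_algClosureOf _ (Or.inl (Or.inl (hmemα hi j)))
    have hβΓ : ∀ {i : ι}, i ∈ J → ∀ j, b i j ∈ Γ := fun hi j =>
      subset_algClosureOf _ (Or.inl (Or.inr (hmemβ hi j)))
    have hT₁Γ : ∀ t ∈ T₁, ψ (X t) ∈ Γ := fun t ht =>
      subset_algClosureOf _ (Or.inr ⟨t, ht, rfl⟩)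
    refine algRank_le_of_subset_closure (Set.union_subset ?_ ?_)
    · exact fun x hx => subset_algClosureOf _ (Or.inl (Or.inl hx))
    · rintro _ ⟨⟨i, j⟩, ht, rfl⟩
      rw [Finset.mem_coe, Finset.mem_sigma] at ht
      obtain ⟨hiJ, hj⟩ := ht
      by_cases hi : i ∈ I
      · exact hT₁Γ _ (by simp only [T₁, Finset.mem_sigma, if_pos hi]; exact ⟨hiJ, hj⟩)
      have hiJI : i ∈ J \ I := Finset.mem_sdiff.2 ⟨hiJ, hi⟩
      by_cases hjj' : j = jj i
      swap
      · refine hT₁Γ _ ?_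
        simp only [T₁, Finset.mem_sigma, if_neg hi]
        exact ⟨hiJ, Finset.mem_erase.2 ⟨hjj', hj⟩⟩
      subst hjj'
      -- Solve the linear equation for the omitted coordinate; its coefficient is non-zero by the
      -- choice of `jj`.
      have hsum := hs i hiJ
      have := sum_mul_univSection (a := a) (j₀ := j₀) ψ.toRingHom i (b i)
      change ∑ j, b i j * ψ (univSection a j₀ ⟨i, j⟩) =
        ∑ j, (b i j - b i (j₀ i) * ψ (C (a i j))) * ψ (X ⟨i, j⟩) at this
      rw [hsum, ← Finset.add_sum_erase _ _ (Finset.mem_univ (jj i)), eq_comm,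
        add_eq_zero_iff_eq_neg] at this
      have hne' : b i (jj i) - b i (j₀ i) * ψ (C (a i (jj i))) ≠ 0 := sub_ne_zero.2 (hjj i hiJI)
      have hx : ψ (X ⟨i, jj i⟩) = (-∑ j ∈ Finset.univ.erase (jj i),
          (b i j - b i (j₀ i) * ψ (C (a i j))) * ψ (X ⟨i, j⟩)) /
          (b i (jj i) - b i (j₀ i) * ψ (C (a i (jj i)))) := by
        rw [eq_div_iff hne', mul_comm, this]
      change ψ (X ⟨i, jj i⟩) ∈ Γ
      rw [hx]
      refine div_mem_algClosureOf (neg_mem (sum_mem fun l hl => ?_))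
        (sub_mem (hβΓ hiJ _) (mul_mem (hβΓ hiJ _) (hαΓ hiJ _)))
      by_cases hl0 : l = j₀ i
      · rw [hl0, ha, C_1, map_one, mul_one, sub_self, zero_mul]
        exact zero_mem _
      · refine mul_mem (sub_mem (hβΓ hiJ _) (mul_mem (hβΓ hiJ _) (hαΓ hiJ _))) (hT₁Γ _ ?_)
        simp only [T₁, Finset.mem_sigma, if_neg hi]
        exact ⟨hiJ, Finset.mem_erase.2 ⟨(Finset.mem_erase.1 hl).1,
          Finset.mem_erase.2 ⟨hl0, Finset.mem_univ _⟩⟩⟩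
  have h3 : algRank ℂ (α J ∪ β ∪ (fun t => ψ (X t)) '' (T₁ : Set (Σ i, N i))) ≤
      algRank ℂ (α J ∪ β) + T₁.card := by
    refine (algRank_union_le _ _).trans ?_
    gcongr
    refine (Set.encard_image_le _ _).trans ?_
    rw [Set.encard_coe_eq_coe_finsetCard]
  -- On `I` the vectors are proportional, so quotients of `b` recover `α I`, which therefore lies in
  -- both closures. Submodularity then bounds the rank of the pair of points by `2 τ_J - τ_I`.
  have h4 : algRank ℂ (α I) + algRank ℂ (α J ∪ β) ≤ algRank ℂ (α J) + algRank ℂ β := by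
    refine algRank_submod ?_ ?_
    · intro x hx
      obtain ⟨i, hi, j, rfl⟩ := Set.mem_iUnion₂.1 hx
      exact subset_algClosureOf _ (hmemα (hIJ hi) j)
    · intro x hx
      obtain ⟨i, hi, j, rfl⟩ := Set.mem_iUnion₂.1 hx
      have h0 : b i (j₀ i) ≠ 0 := by
        intro h
        have := hI i hi (j₁ i)
        rw [hb, h, zero_mul] at this
        exact one_ne_zero this
      have : ψ (C (a i j)) = b i j / b i (j₀ i) := by
        rw [eq_div_iff h0, mul_comm, hI i hi j]
      change ψ (C (a i j)) ∈ _
      rw [this]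
      exact div_mem_algClosureOf (subset_algClosureOf _ (hmemβ (hIJ hi) _))
        (subset_algClosureOf _ (hmemβ (hIJ hi) _))
  have hfin : algRank ℂ (α J) ≠ ⊤ := by
    refine ne_top_of_le_ne_top ?_ (algRank_le_encard _)
    rw [Set.encard_ne_top_iff]
    exact J.finite_toSet.biUnion fun i _ => Set.finite_range _
  have hβ : algRank ℂ β ≤ algRank ℂ (α J) := by rw [hαrank]; exact hrank
  rw [← hαrank, ← hαrank]
  have h123 := h1.trans (h2.trans h3)
  have hfin2 : algRank ℂ (α J ∪ β) ≠ ⊤ := by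
    refine ne_top_of_le_ne_top ?_ (algRank_le_encard _)
    rw [Set.encard_ne_top_iff]
    exact (J.finite_toSet.biUnion fun i _ => Set.finite_range _).union
      (J.finite_toSet.biUnion fun i _ => Set.finite_range _)
  have hfin3 : algRank ℂ (α I) ≠ ⊤ := ne_top_of_le_ne_top
    (WithTop.add_ne_top.2 ⟨hfin, ne_top_of_le_ne_top hfin hβ⟩) (le_self_add.trans h4)
  have hfin4 := ne_top_of_le_ne_top hfin hβ
  rw [hcard] at h123
  lift algRank ℂ (α J) to ℕ using hfin with x
  lift algRank ℂ (α I) to ℕ using hfin3 with y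
  lift algRank ℂ (α J ∪ β) to ℕ using hfin2 with z
  lift algRank ℂ β to ℕ using hfin4 with w
  norm_cast at *
  omega

/-- If every proper subfamily of `J` has larger defect, then the generic sections that vanish at
the generic point have no common zero that is separated from it by the linear series in `J`. -/
theorem exists_generic_unique_zero {ι : Type*} [Fintype ι] [DecidableEq ι] {N : ι → Type*}
    [∀ i, Fintype (N i)]
    [∀ i, DecidableEq (N i)] {A : Type*} [CommRing A] {a : ∀ i, N i → A} {j₀ : ∀ i, N i}
    [IsDomain A] [Algebra ℂ A] (ha : ∀ i, a i (j₀ i) = 1) {J : Finset ι}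
    (hJ : ∀ I ⊂ J, algRank ℂ (⋃ i ∈ J, Set.range (a i)) <
      algRank ℂ (⋃ i ∈ I, Set.range (a i)) + (J \ I).card)
    {A' : Type*} [CommRing A'] [IsDomain A'] [Algebra ℂ A'] {a' : ∀ i, N i → A'} {j₁ : ∀ i, N i}
    (ha' : ∀ i, a' i (j₁ i) = 1)
    (hrank : algRank ℂ (⋃ i ∈ J, Set.range (a' i)) ≤ algRank ℂ (⋃ i ∈ J, Set.range (a i))) :
    ∃ g : MvPolynomial (Σ i, N i) A, g ≠ 0 ∧ ∀ P : ClosedPt (MvPolynomial (Σ i, N i) A), P g ≠ 0 →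
      ∀ q : ClosedPt A', (∀ i ∈ J, ∑ j, q (a' i j) * P (univSection a j₀ ⟨i, j⟩) = 0) →
      ∀ i ∈ J, ∀ j, q (a' i j) = q (a' i (j₀ i)) * P (C (a i j)) := by
  suffices H : ∀ i ∈ J, ∀ j, ∃ g : MvPolynomial (Σ i, N i) A, g ≠ 0 ∧
      ∀ P : ClosedPt (MvPolynomial (Σ i, N i) A), P g ≠ 0 →
      ∀ q : ClosedPt A', (∀ i ∈ J, ∑ j, q (a' i j) * P (univSection a j₀ ⟨i, j⟩) = 0) →
      q (a' i j) = q (a' i (j₀ i)) * P (C (a i j)) by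
    choose! g hg0 hg using H
    refine ⟨∏ i ∈ J, ∏ j, g i j, ?_, ?_⟩
    · exact Finset.prod_ne_zero_iff.2 fun i hi => Finset.prod_ne_zero_iff.2 fun j _ => hg0 i hi j
    · intro P hP q hq i hi j
      rw [map_prod, Finset.prod_ne_zero_iff] at hP
      have := hP i hi
      rw [map_prod, Finset.prod_ne_zero_iff] at this
      exact hg i hi j P (this j (Finset.mem_univ _)) q hq
  intro i hi j
  by_contra! hcon
  -- Dense bad pairs are merged into one generic bad pair. In the ring of all functions on the set
  -- of bad pairs no non-zero polynomial becomes zero, so some prime ideal avoids the images of all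
  -- of them. The fraction field of the quotient then receives both points, the first one
  -- injectively.
  let Bad := {x : ClosedPt (MvPolynomial (Σ i, N i) A) × ClosedPt A' //
    (∀ i ∈ J, ∑ j, x.2 (a' i j) * x.1 (univSection a j₀ ⟨i, j⟩) = 0) ∧
      x.2 (a' i j) ≠ x.2 (a' i (j₀ i)) * x.1 (C (a i j))}
  let R := Bad → ℂ
  let ψ₀ : MvPolynomial (Σ i, N i) A →ₐ[ℂ] R := AlgHom.pi fun x =>
    (x.1.1 : MvPolynomial (Σ i, N i) A →ₐ[ℂ] ℂ)
  let χ₀ : A' →ₐ[ℂ] R := AlgHom.pi fun x => (x.1.2 : A' →ₐ[ℂ] ℂ)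
  have hψ₀ : ∀ g x, ψ₀ g x = x.1.1 g := fun _ _ => rfl
  have hχ₀ : ∀ g x, χ₀ g x = x.1.2 g := fun _ _ => rfl
  have hdisj : Disjoint ((⊥ : Ideal R) : Set R)
      ((nonZeroDivisors (MvPolynomial (Σ i, N i) A)).map ψ₀ : Set R) := by
    rw [Set.disjoint_left]
    rintro _ h0 ⟨g, hg, rfl⟩
    have hg' : g ≠ 0 := nonZeroDivisors.ne_zero hg
    obtain ⟨P, hP, q, hq, hne⟩ := hcon g hg'
    have h0' : ψ₀ g = 0 := h0
    exact hP (congrFun h0' ⟨(P, q), hq, hne⟩)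
  obtain ⟨𝔮, h𝔮, -, h𝔮d⟩ := Ideal.exists_le_prime_disjoint _ _ hdisj
  obtain ⟨L, _, _, θ, hθ⟩ : ∃ (L : Type _) (_ : Field L) (_ : Algebra ℂ L) (θ : R →ₐ[ℂ] L),
      ∀ r, θ r = 0 → r ∈ 𝔮 := by
    refine ⟨FractionRing (R ⧸ 𝔮), inferInstance, inferInstance,
      (IsScalarTower.toAlgHom ℂ (R ⧸ 𝔮) _).comp (Ideal.Quotient.mkₐ ℂ 𝔮), fun r hr => ?_⟩
    rw [← Ideal.Quotient.eq_zero_iff_mem]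
    exact (map_eq_zero_iff _ (IsFractionRing.injective (R ⧸ 𝔮) (FractionRing (R ⧸ 𝔮)))).1 hr
  let ψ := θ.comp ψ₀
  let b : ∀ i, N i → L := fun i j => θ (χ₀ (a' i j))
  have hψinj : Function.Injective ψ := by
    rw [injective_iff_map_eq_zero]
    intro g hg
    by_contra hg0
    exact Set.disjoint_left.1 h𝔮d (hθ _ hg) ⟨g, mem_nonZeroDivisors_of_ne_zero hg0, rfl⟩
  classical
  let I := J.filter fun i => ∀ j, b i j = b i (j₀ i) * ψ (C (a i j))
  have hIJ : I ⊆ J := Finset.filter_subset _ _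
  have hiI : i ∉ I := by
    intro h
    have h1 := (Finset.mem_filter.1 h).2 j
    rw [← sub_eq_zero] at h1
    change θ (χ₀ (a' i j)) - θ (χ₀ (a' i (j₀ i))) * θ (ψ₀ (C (a i j))) = 0 at h1
    rw [← map_mul θ, ← map_sub θ] at h1
    -- The difference is non-zero at each bad pair, hence a unit, and so it survives in `L`.
    have h2 : IsUnit (χ₀ (a' i j) - χ₀ (a' i (j₀ i)) * ψ₀ (C (a i j))) := by
      rw [Pi.isUnit_iff]
      intro x
      exact IsUnit.mk0 _ (sub_ne_zero.2 x.2.2)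
    exact (h2.map θ).ne_zero h1
  have hlt : I ⊂ J := Finset.ssubset_iff_subset_ne.2 ⟨hIJ, fun h => hiI (h ▸ hi)⟩
  refine (hJ I hlt).not_ge ?_
  refine algRank_add_card_sdiff_le ha ψ hψinj hIJ (b := b) (j₁ := j₁) ?_ ?_ ?_ ?_ ?_
  · intro i
    simp [b, ha']
  · refine le_trans ?_ hrank
    have : (⋃ i ∈ J, Set.range (b i)) = (θ.comp χ₀) '' ⋃ i ∈ J, Set.range (a' i) := by
      simp only [Set.image_iUnion, ← Set.range_comp]
      rfl
    rw [this]
    exact algRank_image_le _ _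
  · intro i hi
    exact (Finset.mem_filter.1 hi).2
  · intro i hi
    by_contra! h
    exact (Finset.mem_sdiff.1 hi).2 (Finset.mem_filter.2 ⟨(Finset.mem_sdiff.1 hi).1, h⟩)
  · intro i hi
    have h1 : ∑ j, χ₀ (a' i j) * ψ₀ (univSection a j₀ ⟨i, j⟩) = 0 := by
      ext x
      rw [Finset.sum_apply]
      exact x.2.1 i hi
    have h2 := congrArg θ h1
    rw [map_sum θ, map_zero θ] at h2
    rw [← h2]
    exact Finset.sum_congr rfl fun j _ => (map_mul θ _ _).symm

end UniversalSection

end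

/-! ### Function field, affine opens and normal charts of a variety. -/

noncomputable section

namespace ComplexVariety

variable (X : ComplexVariety)

instance jacobsonSpace_carrier : JacobsonSpace X.carrier :=
  LocallyOfFiniteType.jacobsonSpace X.str

instance compactSpace_carrier : CompactSpace X.carrier :=
  QuasiCompact.compactSpace_of_compactSpace X.str

/-- The function field of a variety. -/
def FunField : Type := X.carrier.functionField

instance : Field X.FunField := inferInstanceAs (Field X.carrier.functionField)

/-- The generic point. -/
abbrev generic : X.carrier := genericPoint X.carrier

variable {X}

theorem generic_mem {U : X.carrier.Opens} {x : X.carrier} (hx : x ∈ U) : X.generic ∈ U :=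
  ((genericPoint_spec X.carrier).mem_open_set_iff U.isOpen).mpr ⟨x, trivial, hx⟩

theorem const_res {U V : X.carrier.Opens} (h : V ≤ U) (c : ℂ) :
    X.res h (X.const U c) = X.const V c := (X.res h).commutes c

instance : Algebra ℂ X.FunField :=
  ((X.carrier.presheaf.germ ⊤ X.generic trivial).hom.comp (X.const ⊤)).toAlgebra

/-- The germ of a regular function at the generic point. -/
def germ {U : X.carrier.Opens} (hU : X.generic ∈ U) : X.Reg U →ₐ[ℂ] X.FunField where
  toRingHom := (X.carrier.presheaf.germ U X.generic hU).hom
  commutes' c := by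
    change (X.carrier.presheaf.germ U X.generic hU).hom (X.const U c) =
      (X.carrier.presheaf.germ ⊤ X.generic trivial).hom (X.const ⊤ c)
    rw [← const_res (le_top : U ≤ ⊤)]
    exact TopCat.Presheaf.germ_res_apply X.carrier.presheaf (homOfLE le_top) X.generic hU _

theorem germ_res {U V : X.carrier.Opens} (h : V ≤ U) (hV : X.generic ∈ V) (f : X.Reg U) :
    germ hV (X.res h f) = germ (h hV) f :=
  TopCat.Presheaf.germ_res_apply X.carrier.presheaf (homOfLE h) X.generic hV f

theorem germ_injective {U : X.carrier.Opens} (hU : X.generic ∈ U) :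
    Function.Injective (germ hU) :=
  germ_injective_of_isIntegral _ _ _

theorem eval_eq_zero_iff {U : X.carrier.Opens} {x : X.carrier} (hx : x ∈ U) (f : X.Reg U) :
    X.eval hx f = 0 ↔ x ∉ X.carrier.basicOpen f :=
  Scheme.evaluation_eq_zero_iff_notMem_basicOpen _ _ hx f

theorem isUnit_res {U V : X.carrier.Opens} (f : X.Reg U) (h : V ≤ U)
    (hV : V ≤ X.carrier.basicOpen f) : IsUnit (X.res h f) := by
  have h1 : IsUnit (X.res (X.carrier.basicOpen_le f) f) :=
    X.carrier.toRingedSpace.isUnit_res_basicOpen f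
  have h2 := h1.map (X.res hV)
  rwa [res_res] at h2

theorem finiteType_reg {U : X.carrier.Opens} (hU : IsAffineOpen U) :
    Algebra.FiniteType ℂ (X.Reg U) := by
  have h1 : (X.str.appLE ⊤ U le_top).hom.FiniteType :=
    Scheme.Hom.finiteType_appLE X.str (isAffineOpen_top _) hU le_top
  have h2 : (X.const U).FiniteType :=
    h1.comp (RingHom.FiniteType.of_surjective _
      (Scheme.ΓSpecIso (CommRingCat.of ℂ)).symm.commRingCatIsoToRingEquiv.surjective)
  exact h2

theorem isClosed_primeIdealOf_iff {U : X.carrier.Opens} (hU : IsAffineOpen U)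
    (p : PrimeSpectrum (X.Reg U)) :
    hU.fromSpec p ∈ X.points ↔ p.asIdeal.IsMaximal := by
  have h := hU.fromSpec.isOpenEmbedding.preimage_closedPoints
  rw [← PrimeSpectrum.isClosed_singleton_iff_isMaximal]
  exact Set.ext_iff.1 h p

theorem mem_basicOpen_fromSpec_iff {U : X.carrier.Opens} (hU : IsAffineOpen U)
    (p : PrimeSpectrum (X.Reg U)) (f : X.Reg U) :
    hU.fromSpec p ∈ X.carrier.basicOpen f ↔ f ∉ p.asIdeal := by
  have h := hU.fromSpec_preimage_basicOpen f
  rw [← PrimeSpectrum.mem_basicOpen, ← h]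
  rfl

theorem exists_closedPt_of_mem {U : X.carrier.Opens} (hU : IsAffineOpen U) {x : X.carrier}
    (hx : x ∈ X.points) (hxU : x ∈ U) :
    ∃ q : ClosedPt (X.Reg U), ∀ f, q f = 0 ↔ X.eval hxU f = 0 := by
  have := finiteType_reg hU
  let p := hU.primeIdealOf ⟨x, hxU⟩
  have hp : hU.fromSpec p = x := hU.fromSpec_primeIdealOf ⟨x, hxU⟩
  have hmax : p.asIdeal.IsMaximal := (isClosed_primeIdealOf_iff hU p).1 (by rwa [hp])
  obtain ⟨q, hq, -⟩ := ClosedPt.exists_ne_zero p.asIdeal (g := 1)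
    ((Ideal.ne_top_iff_one _).1 hmax.ne_top)
  refine ⟨q, fun f => ?_⟩
  rw [eval_eq_zero_iff, ← hp, mem_basicOpen_fromSpec_iff, not_not]
  refine ⟨fun h => ?_, hq f⟩
  have : p.asIdeal = q.toSpec.asIdeal := hmax.eq_of_le q.toSpec.2.ne_top hq
  rw [this]
  exact h

theorem exists_mem_of_closedPt {U : X.carrier.Opens} (hU : IsAffineOpen U)
    (q : ClosedPt (X.Reg U)) :
    ∃ x ∈ X.points, ∃ hxU : x ∈ U, ∀ f, q f = 0 ↔ X.eval hxU f = 0 := by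
  have hmax : q.toSpec.asIdeal.IsMaximal := RingHom.ker_isMaximal_of_surjective
    (q : X.Reg U →ₐ[ℂ] ℂ).toRingHom fun c => ⟨algebraMap ℂ _ c, AlgHomClass.commutes q c⟩
  have hmem : hU.fromSpec q.toSpec ∈ U := by
    have : hU.fromSpec q.toSpec ∈ Set.range hU.fromSpec := ⟨_, rfl⟩
    rwa [hU.range_fromSpec] at this
  refine ⟨hU.fromSpec q.toSpec, (isClosed_primeIdealOf_iff hU _).2 hmax, hmem, fun f => ?_⟩
  rw [eval_eq_zero_iff, mem_basicOpen_fromSpec_iff, not_not]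
  rfl

theorem exists_affine_le {V : X.carrier.Opens} {x : X.carrier} (hx : x ∈ V) :
    ∃ U : X.carrier.Opens, IsAffineOpen U ∧ x ∈ U ∧ U ≤ V := by
  obtain ⟨U, hU, hxU, hUV⟩ := Opens.isBasis_iff_nbhd.1 X.carrier.isBasis_affineOpens hx
  exact ⟨U, hU, hxU, hUV⟩

end ComplexVariety

namespace LineBundle

variable {X : ComplexVariety} {L : LineBundle X}

theorem mem_vanishing_iff {s : ∀ i, X.Reg (L.U i)} (hs : s ∈ L.globalSections) {x : X.carrier}
    {i : L.ι} (hx : x ∈ L.U i) : s ∈ L.vanishing x ↔ X.eval hx (s i) = 0 := by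
  refine ⟨fun h => h i hx, fun h j hj => ?_⟩
  have hm : x ∈ L.U j ⊓ L.U i := ⟨hj, hx⟩
  rw [← X.eval_res inf_le_left hm, hs j i, map_mul, X.eval_res inf_le_right hm, h, mul_zero]

end LineBundle

namespace LinearSeries

variable {X : ComplexVariety}

open ComplexVariety

/-- The germs at the generic point of the sections in a linear series, in some trivialization. -/
def gen (E : LinearSeries X) : E.space →ₗ[ℂ] X.FunField :=
  (germ (E.bundle.cover X.generic).choose_spec).toLinearMap ∘ₗ
    LinearMap.proj (E.bundle.cover X.generic).choose ∘ₗ E.space.subtype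

/-- Another trivialization multiplies all germs by a common factor, so quotients of sections do not
depend on the choice in `gen`. -/
theorem exists_germ_eq_mul_gen (E : LinearSeries X) {i : E.bundle.ι}
    (hi : X.generic ∈ E.bundle.U i) :
    ∃ u : X.FunField, u ≠ 0 ∧ ∀ s : E.space, germ hi (s.1 i) = u * E.gen s := by
  set j := (E.bundle.cover X.generic).choose
  have hj : X.generic ∈ E.bundle.U j := (E.bundle.cover X.generic).choose_spec
  have hij : X.generic ∈ E.bundle.U i ⊓ E.bundle.U j := ⟨hi, hj⟩
  refine ⟨germ hij (E.bundle.g i j : X.Reg _), ((E.bundle.g i j).isUnit.map (germ hij)).ne_zero,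
    fun s => ?_⟩
  have h := congrArg (germ hij) (E.le_globalSections s.2 i j)
  rw [germ_res, map_mul, germ_res] at h
  exact h

/-- A basis of a linear series. -/
abbrev basis (E : LinearSeries X) : Module.Basis (Fin (Module.finrank ℂ E.space)) ℂ E.space :=
  Module.finBasis ℂ E.space

/-- An affine open subset of `X` on which each series of a family has a nowhere vanishing basis
section; `a i j` is the quotient of the `j`-th basis section of the `i`-th series by that one. -/
structure NormalChart {ι : Type} (F : ι → LinearSeries X) where
  A : Type
  [commRing : CommRing A]
  [isDomain : IsDomain A]
  [algebra : Algebra ℂ A]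
  [finiteType : Algebra.FiniteType ℂ A]
  emb : A →ₐ[ℂ] X.FunField
  emb_injective : Function.Injective emb
  a : ∀ i, Fin (Module.finrank ℂ (F i).space) → A
  j₀ : ∀ i, Fin (Module.finrank ℂ (F i).space)
  a_j₀ : ∀ i, a i (j₀ i) = 1
  gen_ne_zero : ∀ i, (F i).gen ((F i).basis (j₀ i)) ≠ 0
  emb_a_mul : ∀ i j, emb (a i j) * (F i).gen ((F i).basis (j₀ i)) = (F i).gen ((F i).basis j)
  exists_point : ∀ q : ClosedPt A, ∃ x ∈ X.points, ∀ i (s : (F i).space),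
    s.1 ∈ (F i).bundle.vanishing x ↔ ∑ j, q (a i j) * (F i).basis.repr s j = 0

attribute [instance] NormalChart.commRing NormalChart.isDomain NormalChart.algebra
  NormalChart.finiteType

/-- The point `x` of the variety corresponds to the point `q` of the chart. -/
def NormalChart.IsAt {ι : Type} {F : ι → LinearSeries X} (C : NormalChart F) (q : ClosedPt C.A)
    (x : X.carrier) : Prop :=
  ∀ i (s : (F i).space),
    s.1 ∈ (F i).bundle.vanishing x ↔ ∑ j, q (C.a i j) * (F i).basis.repr s j = 0

theorem exists_basis_notMem_vanishing (E : LinearSeries X) (x : X.carrier) :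
    ∃ j, (E.basis j).1 ∉ E.bundle.vanishing x := by
  by_contra! h
  obtain ⟨s, hs, hsx⟩ := E.basePointFree x
  refine hsx ?_
  have h1 : (⊤ : Submodule ℂ E.space) ≤ E.hyperplane x := by
    rw [← E.basis.span_eq, Submodule.span_le]
    rintro _ ⟨j, rfl⟩
    exact h j
  exact h1 (Submodule.mem_top (x := ⟨s, hs⟩))

/-- By base-point freeness each series has a basis section that is non-zero at `x`; the chart is an
affine neighbourhood of `x` on which all of these are units. -/
theorem exists_normalChart_at {ι : Type} [Fintype ι] (F : ι → LinearSeries X) (x : X.carrier) :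
    ∃ (U : X.carrier.Opens) (C : NormalChart F), x ∈ U ∧
      ∀ y ∈ X.points, y ∈ U → ∃ q : ClosedPt C.A, C.IsAt q y := by
  choose j₀ hj₀ using fun i => (F i).exists_basis_notMem_vanishing x
  have hc : ∀ i, ∃ (c : (F i).bundle.ι) (hx : x ∈ (F i).bundle.U c),
      X.eval hx (((F i).basis (j₀ i)).1 c) ≠ 0 := by
    intro i
    by_contra! h
    exact hj₀ i h
  choose c hxc hne using hc
  let f : ∀ i, X.Reg ((F i).bundle.U (c i)) := fun i => ((F i).basis (j₀ i)).1 (c i)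
  let V : X.carrier.Opens := Finset.univ.inf fun i => X.carrier.basicOpen (f i)
  have hxV : x ∈ V := by
    rw [← SetLike.mem_coe, Opens.coe_finset_inf]
    simp only [Finset.inf_set_eq_iInter, Function.comp_apply, Set.mem_iInter]
    intro i _
    exact not_not.1 (mt (eval_eq_zero_iff (hxc i) (f i)).2 (hne i))
  obtain ⟨U, hU, hxU, hUV⟩ := exists_affine_le hxV
  have hUb : ∀ i, U ≤ X.carrier.basicOpen (f i) := fun i =>
    hUV.trans (Finset.inf_le (Finset.mem_univ i))
  have hUc : ∀ i, U ≤ (F i).bundle.U (c i) := fun i =>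
    (hUb i).trans (X.carrier.basicOpen_le (f i))
  have hunit : ∀ i, IsUnit (X.res (hUc i) (f i)) := fun i => isUnit_res _ _ (hUb i)
  choose u hu using hunit
  have hη : X.generic ∈ U := generic_mem hxU
  have : Nonempty U := ⟨⟨x, hxU⟩⟩
  have := finiteType_reg hU
  let a : ∀ i, Fin (Module.finrank ℂ (F i).space) → X.Reg U := fun i j =>
    ((u i)⁻¹ : (X.Reg U)ˣ) * X.res (hUc i) (((F i).basis j).1 (c i))
  have ha : ∀ i j, X.res (hUc i) (((F i).basis j).1 (c i)) = u i * a i j := by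
    intro i j
    rw [Units.mul_inv_cancel_left]
  have hval : ∀ (q : ClosedPt (X.Reg U)) (y : X.carrier) (hy : y ∈ U),
      (∀ f, q f = 0 ↔ X.eval hy f = 0) → ∀ i (s : (F i).space),
      s.1 ∈ (F i).bundle.vanishing y ↔ ∑ j, q (a i j) * (F i).basis.repr s j = 0 := by
    intro q y hy hq i s
    rw [LineBundle.mem_vanishing_iff ((F i).le_globalSections s.2) (hUc i hy), ← X.eval_res (hUc i) hy,
      ← hq]
    have hs : X.res (hUc i) (s.1 (c i)) = u i * ∑ j, (F i).basis.repr s j • a i j := by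
      let ev : (F i).space →ₗ[ℂ] X.Reg U := (X.res (hUc i)).toLinearMap ∘ₗ
        LinearMap.proj (c i) ∘ₗ (F i).space.subtype
      change ev s = _
      conv_lhs => rw [← (F i).basis.sum_repr s]
      rw [map_sum, Finset.mul_sum]
      refine Finset.sum_congr rfl fun j _ => ?_
      rw [map_smul, mul_smul_comm, ← ha]
      rfl
    have hqu : q (u i : X.Reg U) ≠ 0 := ((u i).isUnit.map q).ne_zero
    rw [hs, map_mul, mul_eq_zero, or_iff_right hqu, map_sum]
    refine Eq.congr_left (Finset.sum_congr rfl fun j _ => ?_)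
    rw [map_smul, smul_eq_mul, mul_comm]
  refine ⟨U, NormalChart.mk (X.Reg U) (germ hη) (germ_injective hη) a j₀ ?_ ?_ ?_ ?_, hxU, ?_⟩
  · intro i
    change ((u i)⁻¹ : (X.Reg U)ˣ) * X.res (hUc i) (f i) = 1
    rw [← hu, Units.inv_mul]
  · intro i h0
    obtain ⟨w, -, hw⟩ := (F i).exists_germ_eq_mul_gen (hUc i hη)
    have h1 := hw ((F i).basis (j₀ i))
    rw [h0, mul_zero, ← germ_res (hUc i) hη] at h1
    change germ hη (X.res (hUc i) (f i)) = 0 at h1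
    rw [← hu] at h1
    exact ((u i).isUnit.map (germ hη)).ne_zero h1
  · intro i j
    obtain ⟨w, hw0, hw⟩ := (F i).exists_germ_eq_mul_gen (hUc i hη)
    refine mul_left_cancel₀ hw0 ?_
    rw [mul_left_comm, ← hw, ← hw, ← germ_res (hUc i) hη, ← germ_res (hUc i) hη]
    change germ hη (a i j) * germ hη (X.res (hUc i) (f i)) = _
    rw [← hu, mul_comm, ← map_mul, ha i j]
  · intro q
    obtain ⟨y, hy, hyU, hq⟩ := exists_mem_of_closedPt hU q
    exact ⟨y, hy, hval q y hyU hq⟩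
  · intro y hy hyU
    obtain ⟨q, hq⟩ := exists_closedPt_of_mem hU hy hyU
    exact ⟨q, hval q y hyU hq⟩

/-- Finitely many normal charts cover the variety. -/
theorem exists_normalCharts {ι : Type} [Fintype ι] (F : ι → LinearSeries X) :
    ∃ (κ : Type) (_ : Fintype κ) (_ : Nonempty κ) (C : κ → NormalChart F),
      ∀ x ∈ X.points, ∃ α, ∃ q : ClosedPt (C α).A, (C α).IsAt q x := by
  choose U C hU hC using exists_normalChart_at F
  obtain ⟨t, ht⟩ := isCompact_univ.elim_finite_subcover (fun x => (U x : Set X.carrier))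
    (fun x => (U x).isOpen) fun x _ => Set.mem_iUnion.2 ⟨x, hU x⟩
  refine ⟨t, inferInstance, ?_, fun x => C x, fun y hy => ?_⟩
  · obtain ⟨x, hx, -⟩ := Set.mem_iUnion₂.1 (ht (Set.mem_univ X.generic))
    exact ⟨⟨x, hx⟩⟩
  · obtain ⟨x, hx, hyx⟩ := Set.mem_iUnion₂.1 (ht (Set.mem_univ y))
    obtain ⟨q, hq⟩ := hC x y hy hyx
    exact ⟨⟨x, hx⟩, q, hq⟩

end LinearSeries

end

/-! ### Topological dimension of sets of closed points, and the Zariski topology in coordinates. -/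

noncomputable section

/-- An open set that meets the smallest member of a chain of irreducible closed sets sees the whole
chain, since each member is the closure of its trace. -/
theorem topologicalKrullDim_le_of_isOpenCover {Y κ : Type*} [TopologicalSpace Y] (U : κ → Set Y)
    (hU : ∀ i, IsOpen (U i)) (hcov : ∀ y, ∃ i, y ∈ U i) {n : WithBot ℕ∞}
    (h : ∀ i, topologicalKrullDim (U i) ≤ n) : topologicalKrullDim Y ≤ n := by
  refine iSup_le fun l => ?_
  obtain ⟨y, hy⟩ := l.head.isIrreducible.nonempty
  obtain ⟨i, hi⟩ := hcov y
  refine le_trans ?_ (h i)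
  let e := IrreducibleCloseds.orderIsoOfIsOpenEmbedding ((↑) : U i → Y)
    (hU i).isOpenEmbedding_subtypeVal
  have hmem : ∀ k, (((↑) : U i → Y) ⁻¹' (l k : Set Y)).Nonempty := fun k =>
    ⟨⟨y, hi⟩, (show l.head ≤ l k from l.monotone (Fin.zero_le k)) hy⟩
  let l' : LTSeries (IrreducibleCloseds (U i)) :=
    LTSeries.mk l.length (fun k => e.symm ⟨l k, hmem k⟩) fun a b hab =>
      e.symm.strictMono (l.strictMono hab)
  exact Order.LTSeries.length_le_krullDim l'

/-- In a Jacobson space a closed set is the closure of its closed points, so strict chains remain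
strict. -/
theorem topologicalKrullDim_le_closedPoints (Z : Type*) [TopologicalSpace Z] [JacobsonSpace Z] :
    topologicalKrullDim Z ≤ topologicalKrullDim (closedPoints Z) := by
  have hcl : ∀ C : IrreducibleCloseds Z, closure ((C : Set Z) ∩ closedPoints Z) = C := fun C =>
    closure_inter_closedPoints C.isClosed
  refine Order.krullDim_le_of_strictMono (fun C =>
    { carrier := ((↑) : closedPoints Z → Z) ⁻¹' C
      isIrreducible' := ?_
      isClosed' := C.isClosed.preimage continuous_subtype_val }) ?_
  · have h1 : IsIrreducible ((C : Set Z) ∩ closedPoints Z) := by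
      rw [← isIrreducible_iff_closure, hcl]
      exact C.isIrreducible
    obtain ⟨⟨z, hz⟩, h2⟩ := h1
    refine ⟨⟨⟨z, hz.2⟩, hz.1⟩, ?_⟩
    rintro _ _ ⟨u, hu, rfl⟩ ⟨v, hv, rfl⟩ ⟨x, hx, hxu⟩ ⟨y, hy, hyv⟩
    obtain ⟨w, hw, hwuv⟩ := h2 u v hu hv ⟨x, ⟨hx, x.2⟩, hxu⟩ ⟨y, ⟨hy, y.2⟩, hyv⟩
    exact ⟨⟨w, hw.2⟩, hw.1, hwuv⟩
  · intro C D hCD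
    refine lt_of_le_of_ne (fun x hx => hCD.le hx) fun heq => hCD.ne ?_
    have h1 : ((C : Set Z) ∩ closedPoints Z) = (D : Set Z) ∩ closedPoints Z := by
      ext z
      have h2 := Set.ext_iff.1 (congrArg IrreducibleCloseds.carrier heq)
      exact ⟨fun h => ⟨(h2 ⟨z, h.2⟩).1 h.1, h.2⟩, fun h => ⟨(h2 ⟨z, h.2⟩).2 h.1, h.2⟩⟩
    refine SetLike.coe_injective ?_
    rw [← hcl C, ← hcl D, h1]

section ClosedPoints

variable {B : Type*} [CommRing B] [Algebra ℂ B]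

namespace ClosedPt

theorem topologicalKrullDim_le : topologicalKrullDim (ClosedPt B) ≤ ringKrullDim B := by
  rw [← PrimeSpectrum.topologicalKrullDim_eq_ringKrullDim]
  exact isInducing_toSpec.topologicalKrullDim_le

theorem isInducing_comap_localizationAway (h : B) :
    Topology.IsInducing (comap (Algebra.ofId B (Localization.Away h) |>.restrictScalars ℂ)) := by
  refine .of_comp (continuous_comap _) isInducing_toSpec.continuous ?_
  exact (PrimeSpectrum.localization_comap_isInducing (Localization.Away h)
    (Submonoid.powers h)).comp isInducing_toSpec

theorem le_topologicalKrullDim [Algebra.FiniteType ℂ B] :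
    ringKrullDim B ≤ topologicalKrullDim (ClosedPt B) := by
  have : IsJacobsonRing B := isJacobsonRing_of_finiteType (A := ℂ)
  rw [← PrimeSpectrum.topologicalKrullDim_eq_ringKrullDim]
  refine (topologicalKrullDim_le_closedPoints _).trans ?_
  have hex : ∀ p : closedPoints (PrimeSpectrum B), ∃ P : ClosedPt B, P.toSpec = p := by
    rintro ⟨p, hp⟩
    have hmax : p.asIdeal.IsMaximal := (PrimeSpectrum.isClosed_singleton_iff_isMaximal p).1 hp
    obtain ⟨P, hP, -⟩ := exists_ne_zero p.asIdeal (g := 1)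
      ((Ideal.ne_top_iff_one _).1 hmax.ne_top)
    exact ⟨P, PrimeSpectrum.ext (hmax.eq_of_le P.toSpec.2.ne_top hP).symm⟩
  choose f hf using hex
  have hcomp : toSpec ∘ f = Subtype.val := funext hf
  refine Topology.IsInducing.topologicalKrullDim_le (f := f) (.of_comp ?_ isInducing_toSpec.continuous ?_)
  · rw [isInducing_toSpec.continuous_iff, hcomp]
    exact continuous_subtype_val
  · rw [hcomp]
    exact .subtypeVal

/-- Fractions are algebraic over the image of `B`, so the transcendence degree does not change. -/
theorem _root_.ringKrullDim_localizationAway [Algebra.FiniteType ℂ B] [IsDomain B] {h : B}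
    (h0 : h ≠ 0) : ringKrullDim (Localization.Away h) = ringKrullDim B := by
  let T := Localization.Away h
  have hle := powers_le_nonZeroDivisors_of_noZeroDivisors h0
  have : IsDomain T := IsLocalization.isDomain_of_le_nonZeroDivisors (R := B) (M := .powers h) T hle
  have : Algebra.FiniteType B T := IsLocalization.finiteType_of_monoid_fg (Submonoid.powers h) T
  have : Algebra.FiniteType ℂ T := Algebra.FiniteType.trans (S := B) inferInstance this
  let f : B →ₐ[ℂ] T := (Algebra.ofId B T).restrictScalars ℂ
  have hf : Function.Injective f := IsLocalization.injective T hle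
  rw [ringKrullDim_eq_algRank ℂ (R := B) (S := Set.univ)
      (top_le_iff.1 fun x _ => subset_algClosureOf _ trivial),
    ringKrullDim_eq_algRank ℂ (R := T) (S := f '' Set.univ), algRank_image f hf]
  refine top_le_iff.1 fun x _ => ?_
  obtain ⟨⟨r, m⟩, hx⟩ := IsLocalization.surj (Submonoid.powers h) x
  have h1 : f m ∈ algClosureOf ℂ (f '' Set.univ) := subset_algClosureOf _ ⟨_, trivial, rfl⟩
  have h2 : f m * x ∈ algClosureOf ℂ (f '' Set.univ) := by
    rw [mul_comm]
    change x * algebraMap B T m ∈ _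
    rw [hx]
    exact subset_algClosureOf _ ⟨_, trivial, rfl⟩
  rw [mem_algClosureOf] at *
  refine IsAlgebraic.of_mul ?_ h1 h2
  rw [mem_nonZeroDivisors_iff_ne_zero, Ne, map_eq_zero_iff f hf]
  exact nonZeroDivisors.ne_zero (hle m.2)

/-- Serves the lower bound for the Kodaira image, which is only shown to contain a non-empty open
part of an affine variety. -/
theorem le_topologicalKrullDim_ne [Algebra.FiniteType ℂ B] [IsDomain B] {h : B} (h0 : h ≠ 0) :
    ringKrullDim B ≤ topologicalKrullDim {P : ClosedPt B | P h ≠ 0} := by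
  rw [← ringKrullDim_localizationAway h0]
  have : Algebra.FiniteType B (Localization.Away h) :=
    IsLocalization.finiteType_of_monoid_fg (Submonoid.powers h) _
  have : Algebra.FiniteType ℂ (Localization.Away h) :=
    Algebra.FiniteType.trans (S := B) inferInstance this
  refine le_topologicalKrullDim.trans ?_
  have hind := isInducing_comap_localizationAway h
  have hm : ∀ P : ClosedPt (Localization.Away h),
      comap (Algebra.ofId B (Localization.Away h) |>.restrictScalars ℂ) P ∈
        {P : ClosedPt B | P h ≠ 0} := fun P =>
    ((IsLocalization.Away.algebraMap_isUnit (S := Localization.Away h) h).map P).ne_zero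
  exact (hind.codRestrict hm).topologicalKrullDim_le

end ClosedPt

end ClosedPoints

section Zariski

variable {V : Type*} [AddCommGroup V] [Module ℂ V] {σ : Type*}

/-- The point of affine space with the given coordinates. -/
def coordPt (ξ : σ → Module.Dual ℂ V) (v : V) : ClosedPt (MvPolynomial σ ℂ) :=
  MvPolynomial.aeval fun i => ξ i v

theorem coordPt_apply (ξ : σ → Module.Dual ℂ V) (v : V) (f : MvPolynomial σ ℂ) :
    coordPt ξ v f = MvPolynomial.eval (fun i => ξ i v) f := by
  exact DFunLike.congr_fun (MvPolynomial.coe_aeval_eq_eval _) f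

/-- The definition takes all functionals as variables. Substituting for each of them a linear form
in the `ξ i` shows that a spanning family gives the same topology. -/
theorem zariskiTopology_eq_induced (ξ : σ → Module.Dual ℂ V)
    (hξ : Submodule.span ℂ (Set.range ξ) = ⊤) :
    zariskiTopology V = induced (coordPt ξ) inferInstance := by
  refine le_antisymm ?_ (le_generateFrom ?_)
  · rw [← continuous_iff_le_induced, continuous_def]
    intro O hO
    obtain ⟨G, rfl⟩ := ClosedPt.isOpen_iff.1 hO
    have : coordPt ξ ⁻¹' {P | ∃ g ∈ G, P g ≠ 0} =
        ⋃ g ∈ G, {v | MvPolynomial.eval (fun φ => φ v) (MvPolynomial.rename ξ g) ≠ 0} := by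
      ext v
      simp [coordPt_apply, MvPolynomial.eval_rename, Function.comp_def]
    rw [this]
    exact @isOpen_biUnion _ _ (zariskiTopology V) _ _ fun g _ =>
      isOpen_generateFrom_of_mem ⟨_, rfl⟩
  · rintro _ ⟨p, rfl⟩
    have hex : ∀ φ : Module.Dual ℂ V, ∃ L : MvPolynomial σ ℂ,
        ∀ v, MvPolynomial.eval (fun i => ξ i v) L = φ v := by
      intro φ
      have hφ : φ ∈ Submodule.span ℂ (Set.range ξ) := hξ ▸ trivial
      induction hφ using Submodule.span_induction with
      | mem x hx => obtain ⟨i, rfl⟩ := hx; exact ⟨MvPolynomial.X i, by simp⟩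
      | zero => exact ⟨0, by simp⟩
      | add x y _ _ hx hy =>
        obtain ⟨L, hL⟩ := hx
        obtain ⟨L', hL'⟩ := hy
        exact ⟨L + L', by simp [hL, hL']⟩
      | smul c x _ hx =>
        obtain ⟨L, hL⟩ := hx
        exact ⟨MvPolynomial.C c * L, by simp [hL]⟩
    choose L hL using hex
    refine ⟨_, ClosedPt.isOpen_ne (MvPolynomial.bind₁ L p), ?_⟩
    ext v
    simp only [Set.mem_preimage, Set.mem_ofPred_eq, coordPt_apply, MvPolynomial.eval,
      MvPolynomial.eval₂Hom_bind₁]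
    have : (fun φ => (MvPolynomial.eval₂Hom (RingHom.id ℂ) fun i => ξ i v) (L φ)) = fun φ => φ v :=
      funext fun φ => hL φ v
    rw [this]

end Zariski

/-- Clearing denominators in a polynomial expression of fractions with a common denominator. -/
theorem exists_homogenization {σ : Type*} (j : σ) (f : MvPolynomial σ ℂ) :
    ∃ (n : ℕ) (F : MvPolynomial σ ℂ), ∀ {L : Type} [Field L] [Algebra ℂ L] (x : σ → L), x j ≠ 0 →
      MvPolynomial.aeval x F = MvPolynomial.aeval (fun i => x i / x j) f * x j ^ n := by
  induction f using MvPolynomial.induction_on with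
  | C a => exact ⟨0, MvPolynomial.C a, fun x _ => by simp⟩
  | add p q hp hq =>
    obtain ⟨n, F, hF⟩ := hp
    obtain ⟨m, G, hG⟩ := hq
    refine ⟨n + m, F * MvPolynomial.X j ^ m + G * MvPolynomial.X j ^ n, fun x hx => ?_⟩
    simp only [map_add, map_mul, map_pow, MvPolynomial.aeval_X, hF x hx, hG x hx]
    ring
  | mul_X p i hp =>
    obtain ⟨n, F, hF⟩ := hp
    refine ⟨n + 1, F * MvPolynomial.X i, fun x hx => ?_⟩
    simp only [map_mul, MvPolynomial.aeval_X, hF x hx]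
    field_simp
    ring

end

/-! ### The dimension of the Kodaira image as a transcendence degree. -/

noncomputable section

namespace LinearSeries

variable {X : ComplexVariety} (E : LinearSeries X)

/-- The quotients of the sections of a linear series. -/
def ratioSet : Set X.FunField := {z | ∃ s t : E.space, z = E.gen s / E.gen t}

/-- The quotients of the basis sections by the `j`-th one. -/
def ratio (j l : Fin (Module.finrank ℂ E.space)) : X.FunField :=
  E.gen (E.basis l) / E.gen (E.basis j)

theorem algClosureOf_ratio {j : Fin (Module.finrank ℂ E.space)} (hj : E.gen (E.basis j) ≠ 0) :
    algClosureOf ℂ (Set.range (E.ratio j)) = algClosureOf ℂ E.ratioSet := by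
  refine le_antisymm (algClosureOf_mono ?_) (algClosureOf_le ?_)
  · rintro _ ⟨l, rfl⟩
    exact ⟨E.basis l, E.basis j, rfl⟩
  · have h : ∀ s, E.gen s / E.gen (E.basis j) ∈ algClosureOf ℂ (Set.range (E.ratio j)) := by
      intro s
      rw [← E.basis.sum_repr s, map_sum, Finset.sum_div]
      refine sum_mem fun l _ => ?_
      rw [map_smul, smul_div_assoc]
      exact Subalgebra.smul_mem _ (subset_algClosureOf _ (Set.mem_range_self l)) _
    rintro _ ⟨s, t, rfl⟩
    rw [← div_div_div_cancel_right₀ hj]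
    exact div_mem_algClosureOf (h s) (h t)

/-- The coordinate ring of the affine part of the Kodaira image where the `j`-th coordinate does
not vanish. -/
abbrev coordRing (j : Fin (Module.finrank ℂ E.space)) : Subalgebra ℂ X.FunField :=
  Algebra.adjoin ℂ (Set.range (E.ratio j))

instance (j) : Algebra.FiniteType ℂ (E.coordRing j) :=
  (Subalgebra.fg_iff_finiteType _).1 ⟨(Set.finite_range _).toFinset, by rw [Set.Finite.coe_toFinset]⟩

/-- The affine coordinates. -/
def coord (j l : Fin (Module.finrank ℂ E.space)) : E.coordRing j :=
  ⟨E.ratio j l, Algebra.subset_adjoin ⟨l, rfl⟩⟩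

theorem adjoin_coord (j) : Algebra.adjoin ℂ (Set.range (E.coord j)) = ⊤ := by
  have h := Algebra.adjoin_adjoin_coe_preimage (R := ℂ) (s := Set.range (E.ratio j))
  convert h using 2
  ext x
  constructor
  · rintro ⟨l, rfl⟩
    exact ⟨l, rfl⟩
  · rintro ⟨l, hl⟩
    exact ⟨l, Subtype.ext hl⟩

theorem ringKrullDim_coordRing {j} (hj : E.gen (E.basis j) ≠ 0) :
    ringKrullDim (E.coordRing j) = (algRank ℂ E.ratioSet : WithBot ℕ∞) := by
  rw [ringKrullDim_eq_algRank ℂ (S := Set.range (E.coord j)),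
    ← algRank_image (E.coordRing j).val Subtype.val_injective, ← Set.range_comp,
    ← algRank_eq_of_closure_eq (E.algClosureOf_ratio hj)]
  · rfl
  · rw [← top_le_iff, ← E.adjoin_coord j]
    exact Algebra.adjoin_le (subset_algClosureOf _)

/-- The section `E.basis l - q (C.a () l) • E.basis (C.j₀ ())` vanishes at `x`, so `v` kills it: up
to a scalar, `v` is evaluation at `q`. -/
theorem NormalChart.IsAt.repr_eq {E : LinearSeries X} {C : NormalChart fun _ : Unit => E}
    {q : ClosedPt C.A} {x : X.carrier} (h : C.IsAt q x) {v : Module.Dual ℂ E.space}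
    (hv : LinearMap.ker v = E.hyperplane x) (l) :
    v (E.basis l) = q (C.a () l) * v (E.basis (C.j₀ ())) := by
  have hm : E.basis l - q (C.a () l) • E.basis (C.j₀ ()) ∈ LinearMap.ker v := by
    rw [hv]
    change (E.basis l - q (C.a () l) • E.basis (C.j₀ ())).1 ∈ E.bundle.vanishing x
    refine (h () _).2 ?_
    simp only [map_sub, map_smul, Module.Basis.repr_self, Finsupp.coe_sub, Finsupp.coe_smul,
      Pi.sub_apply, Pi.smul_apply, mul_sub, Finset.sum_sub_distrib, Finsupp.single_apply]
    simp [C.a_j₀]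
  rw [LinearMap.mem_ker, map_sub, map_smul, sub_eq_zero] at hm
  exact hm

/-- The coordinates of a Kodaira point satisfy every polynomial relation between the ratios. Ratios
by the `j`-th section need not be regular on the chart, so denominators are cleared before a
relation is evaluated at `q`. -/
theorem exists_closedPt_coordRing {ℓ : ℙ ℂ (Module.Dual ℂ E.space)} (hℓ : ℓ ∈ E.kodairaImage)
    {j} (hj : ℓ.rep (E.basis j) ≠ 0) :
    E.gen (E.basis j) ≠ 0 ∧ ∃ u : ClosedPt (E.coordRing j),
      ∀ l, u (E.coord j l) = ℓ.rep (E.basis l) / ℓ.rep (E.basis j) := by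
  obtain ⟨x, hx, hker⟩ := hℓ
  obtain ⟨κ, _, _, C, hC⟩ := exists_normalCharts fun _ : Unit => E
  obtain ⟨α, q, hq⟩ := hC x hx
  have hrep := hq.repr_eq hker
  rw [hrep] at hj
  have hqj : q ((C α).a () j) ≠ 0 := left_ne_zero_of_mul hj
  have haj : (C α).emb ((C α).a () j) ≠ 0 := by
    rw [Ne, map_eq_zero_iff _ (C α).emb_injective]
    exact fun h => hqj (by rw [h, map_zero])
  have hgen : E.gen (E.basis j) ≠ 0 := by
    rw [← (C α).emb_a_mul () j]
    exact mul_ne_zero haj ((C α).gen_ne_zero ())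
  refine ⟨hgen, ?_⟩
  let φ : MvPolynomial (Fin (Module.finrank ℂ E.space)) ℂ →ₐ[ℂ] E.coordRing j :=
    MvPolynomial.aeval (E.coord j)
  have hφ : Function.Surjective φ := by
    rw [← AlgHom.range_eq_top, ← Algebra.adjoin_range_eq_range_aeval, adjoin_coord]
  let e : MvPolynomial (Fin (Module.finrank ℂ E.space)) ℂ →ₐ[ℂ] ℂ :=
    MvPolynomial.aeval fun l => q ((C α).a () l) / q ((C α).a () j)
  have hker' : ∀ f, φ f = 0 → e f = 0 := by
    intro f hf
    obtain ⟨n, F, hF⟩ := exists_homogenization j f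
    have h1 := hF (L := X.FunField) (fun l => (C α).emb ((C α).a () l)) haj
    have h2 : (fun l => (C α).emb ((C α).a () l) / (C α).emb ((C α).a () j)) = E.ratio j := by
      ext l
      rw [ratio, ← (C α).emb_a_mul () j, ← (C α).emb_a_mul () l,
        mul_div_mul_right _ _ ((C α).gen_ne_zero ())]
    have h3 : MvPolynomial.aeval (E.ratio j) f = 0 := by
      have := congrArg (E.coordRing j).val hf
      rwa [map_zero, MvPolynomial.comp_aeval_apply] at this
    rw [h2, h3, zero_mul] at h1
    have h4 : MvPolynomial.aeval (fun l => (C α).a () l) F = 0 := by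
      refine (C α).emb_injective ?_
      rw [map_zero, ← h1]
      exact MvPolynomial.comp_aeval_apply _ (C α).emb F
    have h5 := hF (L := ℂ) (fun l => q ((C α).a () l)) hqj
    have h6 : q (MvPolynomial.aeval (fun l => (C α).a () l) F) =
        MvPolynomial.aeval (fun l => q ((C α).a () l)) F :=
      MvPolynomial.comp_aeval_apply _ (q : (C α).A →ₐ[ℂ] ℂ) F
    rw [h4, map_zero] at h6
    have h7 : (0 : ℂ) = e f * q ((C α).a () j) ^ n := h6.trans h5
    exact (mul_eq_zero.1 h7.symm).resolve_right (pow_ne_zero _ hqj)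
  obtain ⟨u, hu⟩ := ClosedPt.exists_comap_eq φ hφ (u := e) hker'
  refine ⟨u, fun l => ?_⟩
  have h : u (φ (MvPolynomial.X l)) = e (MvPolynomial.X l) := DFunLike.congr_fun hu _
  simp only [φ, e, MvPolynomial.aeval_X] at h
  refine h.trans ?_
  rw [hrep j, hrep l, mul_div_mul_right _ _ (right_ne_zero_of_mul hj)]

/-- The functional with the given affine coordinates. -/
def functional (j) (u : ClosedPt (E.coordRing j)) : Module.Dual ℂ E.space :=
  E.basis.constr ℂ fun l => u (E.coord j l)

theorem functional_basis (j) (u : ClosedPt (E.coordRing j)) (l) :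
    E.functional j u (E.basis l) = u (E.coord j l) := by
  rw [functional, Module.Basis.constr_basis]

theorem coord_self {j} (hj : E.gen (E.basis j) ≠ 0) : E.coord j j = 1 :=
  Subtype.ext (div_self hj)

theorem functional_ne_zero {j} (hj : E.gen (E.basis j) ≠ 0) (u : ClosedPt (E.coordRing j)) :
    E.functional j u ≠ 0 := by
  intro h
  have := E.functional_basis j u j
  rw [h, E.coord_self hj, map_one] at this
  exact zero_ne_one this

theorem zariskiTopology_dual : zariskiTopology (Module.Dual ℂ E.space) =
    induced (coordPt fun l => Module.Dual.eval ℂ E.space (E.basis l)) inferInstance := by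
  refine zariskiTopology_eq_induced _ ?_
  have : (Set.range fun l => Module.Dual.eval ℂ E.space (E.basis l)) =
      Module.Dual.eval ℂ E.space '' Set.range E.basis := by
    rw [← Set.range_comp]
    rfl
  rw [this, Submodule.span_image, E.basis.span_eq, Submodule.map_top, LinearMap.range_eq_top]
  exact (Module.evalEquiv ℂ E.space).surjective

/-- The point of projective space with the given affine coordinates. -/
def projPt {j} (hj : E.gen (E.basis j) ≠ 0) (u : ClosedPt (E.coordRing j)) :
    ℙ ℂ (Module.Dual ℂ E.space) :=
  Projectivization.mk' ℂ ⟨E.functional j u, E.functional_ne_zero hj u⟩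

theorem exists_rep_projPt {j} (hj : E.gen (E.basis j) ≠ 0) (u : ClosedPt (E.coordRing j)) :
    ∃ c : ℂ, c ≠ 0 ∧ (E.projPt hj u).rep = c • E.functional j u := by
  obtain ⟨c, hc⟩ := Projectivization.exists_smul_eq_mk_rep ℂ (E.functional j u)
    (E.functional_ne_zero hj u)
  exact ⟨c, c.ne_zero, hc.symm⟩

theorem continuous_projPt {j} (hj : E.gen (E.basis j) ≠ 0) :
    @Continuous _ _ inferInstance (projectiveZariskiTopology _) (E.projPt hj) := by
  let _ : TopologicalSpace (Module.Dual ℂ E.space) := zariskiTopology _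
  let _ : TopologicalSpace (ℙ ℂ (Module.Dual ℂ E.space)) := projectiveZariskiTopology _
  have h1 : Continuous (E.functional j) := by
    refine continuous_iff_le_induced.2 ?_
    change _ ≤ induced _ (zariskiTopology _)
    rw [zariskiTopology_dual, induced_compose, ← continuous_iff_le_induced]
    have : (coordPt fun l => Module.Dual.eval ℂ E.space (E.basis l)) ∘ E.functional j =
        ClosedPt.comap (MvPolynomial.aeval (E.coord j)) := by
      funext u
      refine MvPolynomial.algHom_ext fun l => ?_
      change coordPt _ _ (MvPolynomial.X l) = u (MvPolynomial.aeval (E.coord j) (MvPolynomial.X l))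
      rw [coordPt_apply, MvPolynomial.eval_X, MvPolynomial.aeval_X]
      exact E.functional_basis j u l
    rw [this]
    exact ClosedPt.continuous_comap _
  have h2 : Continuous (Projectivization.mk' ℂ : _ → ℙ ℂ (Module.Dual ℂ E.space)) :=
    continuous_coinduced_rng
  exact h2.comp (h1.subtype_mk _)

theorem isOpen_coord_ne_zero (j) (f : MvPolynomial (Fin (Module.finrank ℂ E.space)) ℂ) :
    IsOpen[projectiveZariskiTopology (Module.Dual ℂ E.space)] {ℓ | ℓ.rep (E.basis j) ≠ 0 ∧
      MvPolynomial.aeval (fun l => ℓ.rep (E.basis l) / ℓ.rep (E.basis j)) f ≠ 0} := by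
  rw [isOpen_coinduced]
  obtain ⟨n, F, hF⟩ := exists_homogenization j f
  refine (@isOpen_induced_iff _ _ (zariskiTopology _) _ _).2 ⟨coordPt (fun l => Module.Dual.eval ℂ E.space (E.basis l)) ⁻¹'
    {P | P (MvPolynomial.X j * F) ≠ 0}, ?_, ?_⟩
  · rw [zariskiTopology_dual]
    exact isOpen_induced (ClosedPt.isOpen_ne _)
  · ext ⟨v, hv⟩
    obtain ⟨c, hc⟩ := Projectivization.exists_smul_eq_mk_rep ℂ v hv
    have hrep : ∀ l, (Projectivization.mk' ℂ ⟨v, hv⟩).rep (E.basis l) = c * v (E.basis l) :=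
      fun l => DFunLike.congr_fun hc.symm _
    simp only [Set.mem_preimage, Set.mem_ofPred_eq, hrep, mul_div_mul_left _ _ c.ne_zero,
      mul_ne_zero_iff, map_mul, coordPt_apply, MvPolynomial.eval_X]
    rw [and_iff_right c.ne_zero]
    refine and_congr_right fun hj => ?_
    have h1 : MvPolynomial.eval (fun l => v (E.basis l)) F = _ := hF (L := ℂ) _ hj
    change MvPolynomial.eval (fun l => v (E.basis l)) F ≠ 0 ↔ _
    rw [h1, mul_ne_zero_iff, and_iff_left (pow_ne_zero n (show v (E.basis j) ≠ 0 from hj))]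

/-- Where the `j`-th coordinate is non-zero, the image embeds in the closed points of `coordRing j`,
which bounds the dimension above. For one `j` it also contains a non-empty open subset of them,
which bounds it below. -/
theorem topologicalKrullDim_kodairaImage :
    letI : TopologicalSpace E.kodairaImage :=
      induced Subtype.val (projectiveZariskiTopology (Module.Dual ℂ E.space))
    topologicalKrullDim E.kodairaImage = (algRank ℂ E.ratioSet : WithBot ℕ∞) := by
  let _ : TopologicalSpace (ℙ ℂ (Module.Dual ℂ E.space)) := projectiveZariskiTopology _
  have hopen : ∀ j, IsOpen {ℓ : E.kodairaImage | ℓ.1.rep (E.basis j) ≠ 0} := by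
    intro j
    have := (E.isOpen_coord_ne_zero j 1).preimage
      (continuous_subtype_val : Continuous ((↑) : E.kodairaImage → _))
    simpa using this
  choose hgen ρ hρ using fun j (ℓ : {ℓ : E.kodairaImage | ℓ.1.rep (E.basis j) ≠ 0}) =>
    E.exists_closedPt_coordRing ℓ.1.2 ℓ.2
  have hcont : ∀ j, Continuous (ρ j) := by
    intro j
    rw [continuous_def]
    intro O hO
    obtain ⟨G, rfl⟩ := ClosedPt.isOpen_iff.1 hO
    have : ρ j ⁻¹' {P | ∃ g ∈ G, P g ≠ 0} = ⋃ g ∈ G, ρ j ⁻¹' {P | P g ≠ 0} := by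
      ext
      simp
    rw [this]
    refine isOpen_biUnion fun g _ => ?_
    have hg : g ∈ (MvPolynomial.aeval (E.coord j) :
        MvPolynomial _ ℂ →ₐ[ℂ] E.coordRing j).range := by
      rw [← Algebra.adjoin_range_eq_range_aeval, adjoin_coord]
      trivial
    obtain ⟨f, rfl⟩ := hg
    convert (E.isOpen_coord_ne_zero j f).preimage
      (continuous_subtype_val.comp continuous_subtype_val) using 1
    ext ℓ
    have h1 : ρ j ℓ (MvPolynomial.aeval (E.coord j) f) =
        MvPolynomial.aeval (fun l => ρ j ℓ (E.coord j l)) f :=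
      MvPolynomial.comp_aeval_apply _ (ρ j ℓ : E.coordRing j →ₐ[ℂ] ℂ) f
    simp only [hρ] at h1
    change ρ j ℓ (MvPolynomial.aeval (E.coord j) f) ≠ 0 ↔ _
    rw [h1]
    exact (and_iff_right ℓ.2).symm
  refine le_antisymm ?_ ?_
  · refine topologicalKrullDim_le_of_isOpenCover _ hopen ?_ fun j => ?_
    · intro ℓ
      by_contra! h
      exact ℓ.1.rep_nonzero (E.basis.ext fun j => not_not.1 (h j))
    · by_cases hne : Nonempty {ℓ : E.kodairaImage | ℓ.1.rep (E.basis j) ≠ 0}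
      · have hj : E.gen (E.basis j) ≠ 0 := hgen j hne.some
        rw [← E.ringKrullDim_coordRing hj]
        refine le_trans ?_ ClosedPt.topologicalKrullDim_le
        refine Topology.IsInducing.topologicalKrullDim_le (f := ρ j)
          (.of_comp (hcont j) (E.continuous_projPt hj) ?_)
        convert Topology.IsInducing.subtypeVal.comp Topology.IsInducing.subtypeVal using 1
        funext ℓ
        have : E.functional j (ρ j ℓ) = (ℓ.1.1.rep (E.basis j))⁻¹ • ℓ.1.1.rep := by
          refine E.basis.ext fun l => ?_
          rw [functional_basis, hρ, LinearMap.smul_apply, smul_eq_mul, div_eq_inv_mul]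
        change Projectivization.mk ℂ _ _ = ℓ.1.1
        conv_rhs => rw [← ℓ.1.1.mk_rep]
        rw [Projectivization.mk_eq_mk_iff']
        exact ⟨_, this.symm⟩
      · rw [not_nonempty_iff] at hne
        have : IsEmpty (IrreducibleCloseds {ℓ : E.kodairaImage | ℓ.1.rep (E.basis j) ≠ 0}) :=
          ⟨fun C => hne.elim C.isIrreducible.nonempty.some⟩
        rw [topologicalKrullDim, Order.krullDim_eq_bot]
        exact bot_le
  · obtain ⟨κ, _, ⟨α⟩, C, -⟩ := exists_normalCharts fun _ : Unit => E
    set j := (C α).j₀ ()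
    have hj : E.gen (E.basis j) ≠ 0 := (C α).gen_ne_zero ()
    rw [← E.ringKrullDim_coordRing hj]
    have hr : Set.range (E.ratio j) ⊆ (C α).emb.range := by
      rintro _ ⟨l, rfl⟩
      refine ⟨(C α).a () l, ?_⟩
      rw [ratio, eq_div_iff hj]
      exact (C α).emb_a_mul () l
    let φ : E.coordRing j →ₐ[ℂ] (C α).A :=
      ((AlgEquiv.ofInjective (C α).emb (C α).emb_injective).symm : _ →ₐ[ℂ] _).comp
        (Subalgebra.inclusion (Algebra.adjoin_le hr))
    have hφemb : ∀ z, (C α).emb (φ z) = z := fun z => congrArg Subtype.val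
      ((AlgEquiv.ofInjective (C α).emb (C α).emb_injective).apply_symm_apply
        (Subalgebra.inclusion (Algebra.adjoin_le hr) z))
    have hφ : Function.Injective φ := fun z w h => Subtype.ext (by rw [← hφemb, h, hφemb])
    have hφa : ∀ l, φ (E.coord j l) = (C α).a () l := by
      intro l
      refine (C α).emb_injective ?_
      rw [hφemb]
      change E.ratio j l = _
      rw [ratio, div_eq_iff hj]
      exact ((C α).emb_a_mul () l).symm
    -- The chart dominates the affine variety, so every closed point with `h ≠ 0` comes from a point
    -- of `X`.
    obtain ⟨h, h0, hlift⟩ := exists_lift_closedPt φ hφ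
    refine (ClosedPt.le_topologicalKrullDim_ne h0).trans ?_
    have hmem : ∀ u : ClosedPt (E.coordRing j), u h ≠ 0 → E.projPt hj u ∈ E.kodairaImage := by
      intro u hu
      obtain ⟨q, rfl⟩ := hlift u hu
      obtain ⟨x, hx, hqx⟩ := (C α).exists_point q
      refine ⟨x, hx, ?_⟩
      obtain ⟨c, hc, hrep⟩ := E.exists_rep_projPt hj (ClosedPt.comap φ q)
      ext s
      rw [hrep, LinearMap.mem_ker, LinearMap.smul_apply, smul_eq_zero, or_iff_right hc]
      refine Iff.trans ?_ (hqx () s).symm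
      refine Eq.congr_left ?_
      conv_lhs => rw [← E.basis.sum_repr s]
      simp only [map_sum, map_smul, functional_basis, ClosedPt.comap_apply, hφa, smul_eq_mul]
      exact Finset.sum_congr rfl fun l _ => mul_comm _ _
    refine Topology.IsInducing.topologicalKrullDim_le
      (f := fun u : {u : ClosedPt (E.coordRing j) | u h ≠ 0} =>
        (⟨E.projPt hj u.1, hmem u.1 u.2⟩ : E.kodairaImage)) ?_
    have hne : ∀ u : ClosedPt (E.coordRing j), (E.projPt hj u).rep (E.basis j) ≠ 0 := by
      intro u
      obtain ⟨c, hc, hrep⟩ := E.exists_rep_projPt hj u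
      rw [hrep, LinearMap.smul_apply, functional_basis, E.coord_self hj, map_one]
      simpa using hc
    let Φ : {u : ClosedPt (E.coordRing j) | u h ≠ 0} →
        {ℓ : E.kodairaImage | ℓ.1.rep (E.basis j) ≠ 0} := fun u =>
      ⟨⟨E.projPt hj u.1, hmem u.1 u.2⟩, hne u.1⟩
    have hΦ : Continuous Φ := (((E.continuous_projPt hj).comp
      continuous_subtype_val).subtype_mk _).subtype_mk _
    refine Topology.IsInducing.subtypeVal.comp (f := Φ) (.of_comp hΦ (hcont j) ?_)
    convert Topology.IsInducing.subtypeVal using 1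
    funext u
    obtain ⟨c, hc, hrep⟩ := E.exists_rep_projPt hj u.1
    have hcoord : ∀ l, ρ j (Φ u) (E.coord j l) = u.1 (E.coord j l) := by
      intro l
      rw [hρ]
      change (E.projPt hj u.1).rep _ / (E.projPt hj u.1).rep _ = _
      rw [hrep, LinearMap.smul_apply, LinearMap.smul_apply, functional_basis, functional_basis,
        E.coord_self hj, map_one]
      simp [hc]
    exact AlgHom.ext_of_adjoin_eq_top (E.adjoin_coord j) (by
      rintro _ ⟨l, rfl⟩
      exact hcoord l)

/-- Turns defects into transcendence degrees. The rank is finite, so the default values in `tau`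
never apply. -/
theorem algRank_ratioSet : algRank ℂ E.ratioSet = E.tau := by
  have h := E.topologicalKrullDim_kodairaImage
  have hfin : algRank ℂ E.ratioSet ≠ ⊤ := by
    obtain ⟨κ, _, ⟨α⟩, C, -⟩ := exists_normalCharts fun _ : Unit => E
    rw [← algRank_eq_of_closure_eq (E.algClosureOf_ratio ((C α).gen_ne_zero ()))]
    exact ne_top_of_le_ne_top (Set.finite_range _).encard_lt_top.ne (algRank_le_encard _)
  have h2 : E.tau = (algRank ℂ E.ratioSet).toNat := by
    rw [tau, h]
    rfl
  rw [h2, ENat.natCast_toNat hfin]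

end LinearSeries

end

/-! ### Products of linear series. -/

noncomputable section

theorem ComplexVariety.eval_smul (X : ComplexVariety) {U : X.carrier.Opens} {x : X.carrier}
    (hx : x ∈ U) (c : ℂ) (f : X.Reg U) : X.eval hx (c • f) =
      X.eval (U := ⊤) (Set.mem_univ x) (X.const ⊤ c) * X.eval hx f := by
  rw [Algebra.smul_def, map_mul, ← X.eval_res le_top hx]
  congr 2
  exact ((X.res le_top).commutes c).symm

namespace LinearSeries

variable {X : ComplexVariety}

open ComplexVariety

theorem exists_gen_ne_zero (E : LinearSeries X) : ∃ s, E.gen s ≠ 0 := by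
  obtain ⟨κ, _, ⟨α⟩, C, -⟩ := exists_normalCharts fun _ : Unit => E
  exact ⟨_, (C α).gen_ne_zero ()⟩

/-- At a closed point the sections of a linear series have values in a line. -/
theorem exists_sub_mem_vanishing (E : LinearSeries X) {x : X.carrier} (hx : x ∈ X.points) :
    ∃ b : E.space, b.1 ∉ E.bundle.vanishing x ∧
      ∀ s : E.space, ∃ c : ℂ, s - c • b ∈ E.hyperplane x := by
  obtain ⟨κ, _, _, C, hC⟩ := exists_normalCharts fun _ : Unit => E
  obtain ⟨α, q, hq⟩ := hC x hx
  refine ⟨E.basis ((C α).j₀ ()), fun h => ?_,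
    fun s => ⟨∑ j, q ((C α).a () j) * E.basis.repr s j, ?_⟩⟩
  · have := (hq () _).1 h
    simp [Finsupp.single_apply, (C α).a_j₀] at this
  · change (s - _ • E.basis ((C α).j₀ ())).1 ∈ E.bundle.vanishing x
    refine (hq () _).2 ?_
    simp only [map_sub, map_smul, Module.Basis.repr_self, Finsupp.coe_sub, Finsupp.coe_smul,
      Pi.sub_apply, Pi.smul_apply, mul_sub, Finset.sum_sub_distrib, Finsupp.single_apply]
    simp [(C α).a_j₀]

section Prod

variable {κ : Type} [Fintype κ] (E : κ → LinearSeries X)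

/-- The product of sections. -/
def prodSection (s : ∀ j, (E j).space) : (prod E).space :=
  ⟨LineBundle.tensorSections (fun j => (E j).bundle) fun j => (s j).1,
    (Submodule.subset_span ⟨s, rfl⟩ : _ ∈ Submodule.span ℂ {t | ∃ s : ∀ j, (E j).space,
      t = LineBundle.tensorSections (fun j => (E j).bundle) fun j => (s j).1})⟩

theorem le_of_mem_prod {x : X.carrier} {a} (hx : x ∈ (prod E).bundle.U a) (j) :
    x ∈ (E j).bundle.U (a j) :=
  (Finset.inf_le (Finset.mem_univ j) :
    (LineBundle.tensor fun j => (E j).bundle).U a ≤ (E j).bundle.U (a j)) hx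

theorem germ_prodSection {a} (ha : X.generic ∈ (prod E).bundle.U a) (s : ∀ j, (E j).space) :
    germ ha ((prodSection E s).1 a) = ∏ j, germ (le_of_mem_prod E ha j) ((s j).1 (a j)) := by
  refine (congrArg (germ ha) (LineBundle.tensorSections_apply _ _ a)).trans ?_
  refine (map_prod (germ ha) _ _).trans (Finset.prod_congr rfl fun j _ => germ_res _ ha _)

theorem eval_prodSection {x : X.carrier} {a} (ha : x ∈ (prod E).bundle.U a)
    (s : ∀ j, (E j).space) : X.eval ha ((prodSection E s).1 a) =
      ∏ j, X.eval (le_of_mem_prod E ha j) ((s j).1 (a j)) := by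
  refine (congrArg (X.eval ha) (LineBundle.tensorSections_apply _ _ a)).trans ?_
  refine (map_prod (X.eval ha) _ _).trans (Finset.prod_congr rfl fun j _ => X.eval_res _ ha _)

theorem exists_gen_prodSection : ∃ w : X.FunField, w ≠ 0 ∧
    ∀ s : ∀ j, (E j).space, (prod E).gen (prodSection E s) = w * ∏ j, (E j).gen (s j) := by
  obtain ⟨a, ha⟩ := (prod E).bundle.cover X.generic
  obtain ⟨u, hu, h⟩ := (prod E).exists_germ_eq_mul_gen ha
  choose v hv h' using fun j => (E j).exists_germ_eq_mul_gen (le_of_mem_prod E ha j)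
  refine ⟨u⁻¹ * ∏ j, v j, mul_ne_zero (inv_ne_zero hu) (Finset.prod_ne_zero_iff.2 fun j _ => hv j),
    fun s => ?_⟩
  rw [mul_assoc, ← Finset.prod_mul_distrib, eq_inv_mul_iff_mul_eq₀ hu, ← h, germ_prodSection]
  exact Finset.prod_congr rfl fun j _ => h' j _

theorem prod_induction {p : (prod E).space → Prop} (h : ∀ s, p (prodSection E s)) (h0 : p 0)
    (hadd : ∀ S T, p S → p T → p (S + T)) (hsmul : ∀ (c : ℂ) S, p S → p (c • S)) (S) : p S := by
  obtain ⟨S, hS⟩ := S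
  induction hS using Submodule.span_induction with
  | mem x hx => obtain ⟨s, rfl⟩ := hx; exact h s
  | zero => exact h0
  | add x y hx hy h1 h2 => exact hadd ⟨x, hx⟩ ⟨y, hy⟩ h1 h2
  | smul c x hx h1 => exact hsmul c ⟨x, hx⟩ h1

/-- A ratio of products of sections is a product of ratios. Conversely, two products that differ in
a single factor have the ratio of that factor. -/
theorem algClosureOf_ratioSet_prod [DecidableEq κ] :
    algClosureOf ℂ (prod E).ratioSet = algClosureOf ℂ (⋃ j, (E j).ratioSet) := by
  obtain ⟨w, hw, hgen⟩ := exists_gen_prodSection E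
  choose b hb using fun j => (E j).exists_gen_ne_zero
  have hb' : (prod E).gen (prodSection E b) ≠ 0 := by
    rw [hgen]
    exact mul_ne_zero hw (Finset.prod_ne_zero_iff.2 fun j _ => hb j)
  refine le_antisymm (algClosureOf_le ?_) (algClosureOf_le ?_)
  · have h : ∀ S, (prod E).gen S / (prod E).gen (prodSection E b) ∈
        algClosureOf ℂ (⋃ j, (E j).ratioSet) := by
      refine prod_induction E (fun s => ?_) ?_ (fun S T hS hT => ?_) fun c S hS => ?_
      · rw [hgen, hgen, mul_div_mul_left _ _ hw, ← Finset.prod_div_distrib]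
        exact prod_mem fun j _ => subset_algClosureOf _ (Set.mem_iUnion.2 ⟨j, _, _, rfl⟩)
      · rw [map_zero, zero_div]
        exact zero_mem _
      · rw [map_add, add_div]
        exact add_mem hS hT
      · rw [map_smul, smul_div_assoc]
        exact Subalgebra.smul_mem _ hS _
    rintro _ ⟨S, T, rfl⟩
    rw [← div_div_div_cancel_right₀ hb']
    exact div_mem_algClosureOf (h S) (h T)
  · refine Set.iUnion_subset fun j => ?_
    rintro _ ⟨s, t, rfl⟩
    have h : ∀ s, (prod E).gen (prodSection E (Function.update b j s)) =
        (w * ∏ i ∈ Finset.univ.erase j, (E i).gen (b i)) * (E j).gen s := by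
      intro s
      rw [hgen, ← Finset.mul_prod_erase _ _ (Finset.mem_univ j), Function.update_self, mul_assoc,
        mul_comm ((E j).gen s)]
      congr 2
      exact Finset.prod_congr rfl fun i hi => by
        rw [Function.update_of_ne (Finset.ne_of_mem_erase hi)]
    refine subset_algClosureOf _ ⟨prodSection E (Function.update b j s),
      prodSection E (Function.update b j t), ?_⟩
    rw [h, h, mul_div_mul_left]
    exact mul_ne_zero hw (Finset.prod_ne_zero_iff.2 fun j _ => hb j)

theorem prodSection_mem_vanishing_iff {x : X.carrier} (s : ∀ j, (E j).space) :
    (prodSection E s).1 ∈ (prod E).bundle.vanishing x ↔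
      ∃ j, (s j).1 ∈ (E j).bundle.vanishing x := by
  obtain ⟨a, ha⟩ := (prod E).bundle.cover x
  rw [LineBundle.mem_vanishing_iff ((prod E).le_globalSections (prodSection E s).2) ha,
    eval_prodSection, Finset.prod_eq_zero_iff]
  simp only [Finset.mem_univ, true_and]
  refine exists_congr fun j => ?_
  rw [← LineBundle.mem_vanishing_iff ((E j).le_globalSections (s j).2)]

theorem prodSection_sub_mem {x : X.carrier} {s b : ∀ j, (E j).space} {c : κ → ℂ}
    (h : ∀ j, s j - c j • b j ∈ (E j).hyperplane x) :
    prodSection E s - (∏ j, c j) • prodSection E b ∈ (prod E).hyperplane x := by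
  obtain ⟨a, ha⟩ := (prod E).bundle.cover x
  refine (LineBundle.mem_vanishing_iff ((prod E).le_globalSections
    (prodSection E s - (∏ j, c j) • prodSection E b).2) ha).2 ?_
  change X.eval ha ((prodSection E s).1 a - (∏ j, c j) • (prodSection E b).1 a) = 0
  have h' : ∀ j, X.eval (le_of_mem_prod E ha j) ((s j).1 (a j)) = X.eval (Set.mem_univ x)
      (X.const ⊤ (c j)) * X.eval (le_of_mem_prod E ha j) ((b j).1 (a j)) := by
    intro j
    have := h j (a j) (le_of_mem_prod E ha j)
    rw [← X.eval_smul, ← sub_eq_zero, ← map_sub]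
    exact this
  rw [map_sub, X.eval_smul, eval_prodSection, eval_prodSection, map_prod, map_prod,
    ← Finset.prod_mul_distrib, sub_eq_zero]
  exact Finset.prod_congr rfl fun j _ => h' j

/-- This lets copies of `E_J` replace the series in `J`. Sections are compared with the product of
sections `b j` that do not vanish at `x`. Varying one factor of it recovers each hyperplane;
conversely, equal hyperplanes of the factors give each product section the same scalar at `x` and at
`y`. -/
theorem hyperplane_prod_eq_iff [DecidableEq κ] {x y : X.carrier} (hx : x ∈ X.points) :
    (prod E).hyperplane x = (prod E).hyperplane y ↔
      ∀ j, (E j).hyperplane x = (E j).hyperplane y := by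
  choose b hb hc using fun j => (E j).exists_sub_mem_vanishing hx
  constructor
  · intro h j
    have hmem : ∀ s, (prodSection E s).1 ∈ (prod E).bundle.vanishing x ↔
        (prodSection E s).1 ∈ (prod E).bundle.vanishing y := fun s => SetLike.ext_iff.1 h (prodSection E s)
    have hby : ∀ i, (b i).1 ∉ (E i).bundle.vanishing y := by
      intro i hi
      obtain ⟨l, hl⟩ := (prodSection_mem_vanishing_iff E b).1 ((hmem b).2
        ((prodSection_mem_vanishing_iff E b).2 ⟨i, hi⟩))
      exact hb l hl
    have key : ∀ z, (∀ i, (b i).1 ∉ (E i).bundle.vanishing z) → ∀ s,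
        (prodSection E (Function.update b j s)).1 ∈ (prod E).bundle.vanishing z ↔
          s ∈ (E j).hyperplane z := by
      intro z hz s
      rw [prodSection_mem_vanishing_iff]
      constructor
      · rintro ⟨i, hi⟩
        by_cases hij : i = j
        · subst hij
          rwa [Function.update_self] at hi
        · rw [Function.update_of_ne hij] at hi
          exact absurd hi (hz i)
      · intro h
        exact ⟨j, by rwa [Function.update_self]⟩
    ext s
    rw [← key x hb, ← key y hby, hmem]
  · intro h
    have hby : ∀ i, (b i).1 ∉ (E i).bundle.vanishing y := fun i hi =>
      hb i (show b i ∈ (E i).hyperplane x from (h i).symm ▸ hi)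
    have key : ∀ S : (prod E).space, ∃ c : ℂ,
        S - c • prodSection E b ∈ (prod E).hyperplane x ⊓ (prod E).hyperplane y := by
      refine prod_induction E (fun s => ?_) ⟨0, by simp⟩ ?_ ?_
      · choose c hc using fun j => hc j (s j)
        exact ⟨∏ j, c j, prodSection_sub_mem E hc,
          prodSection_sub_mem E fun j => h j ▸ hc j⟩
      · rintro S T ⟨c, hc⟩ ⟨c', hc'⟩
        refine ⟨c + c', ?_⟩
        rw [add_smul, add_sub_add_comm]
        exact add_mem hc hc'
      · rintro c S ⟨c', hc'⟩
        refine ⟨c * c', ?_⟩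
        have h1 := Submodule.smul_mem _ c hc'
        rwa [smul_sub, smul_smul] at h1
    have hmem : ∀ z, (∀ i, (b i).1 ∉ (E i).bundle.vanishing z) → ∀ (S : (prod E).space) (c : ℂ),
        S - c • prodSection E b ∈ (prod E).hyperplane z → (S ∈ (prod E).hyperplane z ↔ c = 0) := by
      intro z hz S c hS
      have h1 : prodSection E b ∉ (prod E).hyperplane z := fun h => by
        obtain ⟨i, hi⟩ := (prodSection_mem_vanishing_iff E b).1 h
        exact hz i hi
      refine ⟨fun h => ?_, fun h => by simpa [h] using hS⟩
      by_contra hc0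
      have h2 := Submodule.sub_mem _ h hS
      rw [sub_sub_cancel] at h2
      exact h1 ((Submodule.smul_mem_iff _ hc0).1 h2)
    ext S
    obtain ⟨c, hcx, hcy⟩ := key S
    rw [hmem x hb S c hcx, hmem y hby S c hcy]

end Prod

end LinearSeries

end

/-! ### Defects of a collection and of its reduction. -/

noncomputable section

namespace LinearSeries

variable {X : ComplexVariety} {ι : Type} (F : ι → LinearSeries X)

/-- The transcendence degree generated by the quotients of the sections of some of the series. -/
def ratioRank (T : Finset ι) : ℕ∞ := algRank ℂ (⋃ i ∈ T, (F i).ratioSet)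

theorem ratioRank_empty : ratioRank F ∅ = 0 := by
  have h : (⋃ i ∈ (∅ : Finset ι), (F i).ratioSet) = ∅ := by simp
  rw [ratioRank, h]
  exact le_antisymm ((algRank_le_encard _).trans Set.encard_empty.le) bot_le

theorem ratioRank_union_le [DecidableEq ι] (S T : Finset ι) :
    ratioRank F (S ∪ T) ≤ ratioRank F S + ratioRank F T := by
  have h := algRank_submod (k := ℂ) (S := ⋃ i ∈ S, (F i).ratioSet) (T := ⋃ i ∈ T, (F i).ratioSet)
    (Set.empty_subset _) (Set.empty_subset _)
  rw [ratioRank, Finset.set_biUnion_union]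
  exact le_add_self.trans h

/-- The functions `C.a i` are the ratios by one basis section, which generate all ratios of the
series. -/
theorem algRank_normalChart (C : NormalChart F) (T : Finset ι) :
    algRank ℂ (⋃ i ∈ T, Set.range (C.a i)) = ratioRank F T := by
  rw [← algRank_image C.emb C.emb_injective, Set.image_iUnion₂]
  have h : ∀ i, C.emb '' Set.range (C.a i) = Set.range ((F i).ratio (C.j₀ i)) := by
    intro i
    rw [← Set.range_comp]
    congr 1
    funext j
    exact (eq_div_iff (C.gen_ne_zero i)).2 (C.emb_a_mul i j)
  simp only [h]
  refine algRank_eq_of_closure_eq (le_antisymm (algClosureOf_le ?_) (algClosureOf_le ?_)) <;>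
    refine Set.iUnion₂_subset fun i hi => (subset_algClosureOf (k := ℂ) _).trans ?_
  · rw [(F i).algClosureOf_ratio (C.gen_ne_zero i)]
    exact algClosureOf_mono (Set.subset_biUnion_of_mem (u := fun i => (F i).ratioSet) hi)
  · rw [← (F i).algClosureOf_ratio (C.gen_ne_zero i)]
    exact algClosureOf_mono (Set.subset_biUnion_of_mem
      (u := fun i => Set.range ((F i).ratio (C.j₀ i))) hi)

end LinearSeries

namespace Collection

open LinearSeries

variable {X : ComplexVariety} {k : ℕ} (E : Collection X k)

theorem algClosureOf_ratioSet_prodOn (J : Finset (Fin k)) :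
    algClosureOf ℂ (E.prodOn J).ratioSet = algClosureOf ℂ (⋃ i ∈ J, (E i).ratioSet) := by
  rw [prodOn, algClosureOf_ratioSet_prod, Set.iUnion_subtype]

theorem coe_tau_prodOn (J : Finset (Fin k)) : ((E.prodOn J).tau : ℕ∞) = ratioRank E J := by
  rw [← algRank_ratioSet, algRank_eq_of_closure_eq (E.algClosureOf_ratioSet_prodOn J), ratioRank]

theorem minDefect_le (J : Finset (Fin k)) : E.minDefect ≤ E.defect J :=
  Finset.inf'_le _ (Finset.mem_univ J)

theorem minDefect_nonpos : E.minDefect ≤ 0 := by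
  refine (E.minDefect_le ∅).trans ?_
  have h := E.coe_tau_prodOn ∅
  rw [ratioRank_empty] at h
  rw [defect, Nat.cast_eq_zero.1 h]
  simp

theorem exists_isEssential : ∃ J, E.IsEssential J := by
  obtain ⟨J₀, -, hJ₀⟩ := Finset.exists_mem_eq_inf' Finset.univ_nonempty E.defect
  obtain ⟨J, hJ⟩ := ((Finset.univ.filter fun J => E.defect J = E.minDefect)).exists_minimal
    ⟨J₀, Finset.mem_filter.2 ⟨Finset.mem_univ _, hJ₀.symm⟩⟩
  have hJE : E.defect J = E.minDefect := (Finset.mem_filter.1 hJ.1).2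
  refine ⟨J, hJE, fun I hI => ?_⟩
  rw [hJE]
  refine lt_of_le_of_ne (E.minDefect_le I) fun h => hI.2 (hJ.2 ?_ hI.1)
  simp [h]

/-- The series of a collection, together with `m` copies of the product over `J`. -/
def adjoinProd (J : Finset (Fin k)) (m : ℕ) : Fin k ⊕ Fin m → LinearSeries X :=
  Sum.elim E fun _ => E.prodOn J

variable {E} {J : Finset (Fin k)} {m : ℕ}

theorem ratioSet_subset_of_inr {T : Finset (Fin k ⊕ Fin m)} {p : Fin m} (hp : Sum.inr p ∈ T) :
    (⋃ i ∈ J, (E i).ratioSet) ⊆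
      algClosureOf ℂ (⋃ z ∈ T, (E.adjoinProd J m z).ratioSet) := by
  refine (subset_algClosureOf (k := ℂ) _).trans ?_
  rw [← algClosureOf_ratioSet_prodOn]
  exact algClosureOf_mono (Set.subset_biUnion_of_mem
    (u := fun z => (E.adjoinProd J m z).ratioSet) hp)

theorem ratioRank_toLeft_le (T : Finset (Fin k ⊕ Fin m)) :
    ratioRank E T.toLeft ≤ ratioRank (E.adjoinProd J m) T := by
  refine algRank_mono (Set.iUnion₂_subset fun i hi => ?_)
  exact Set.subset_biUnion_of_mem (u := fun z => (E.adjoinProd J m z).ratioSet)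
    (Finset.mem_toLeft.1 hi)

theorem ratioRank_union_toLeft_le {T : Finset (Fin k ⊕ Fin m)} {p : Fin m}
    (hp : Sum.inr p ∈ T) : ratioRank E (J ∪ T.toLeft) ≤ ratioRank (E.adjoinProd J m) T := by
  refine algRank_le_of_subset_closure ?_
  rw [Finset.set_biUnion_union]
  refine Set.union_subset (ratioSet_subset_of_inr hp) (Set.Subset.trans
    (Set.iUnion₂_subset fun i hi => ?_) (subset_algClosureOf _))
  exact Set.subset_biUnion_of_mem (u := fun z => (E.adjoinProd J m z).ratioSet)
    (Finset.mem_toLeft.1 hi)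

theorem ratioRank_of_toLeft_eq_empty {T : Finset (Fin k ⊕ Fin m)} (hT : T.toLeft = ∅)
    (hne : T.Nonempty) : ratioRank (E.adjoinProd J m) T = ratioRank E J := by
  have hinr : ∀ z ∈ T, ∃ p, z = Sum.inr p := by
    rintro (i | p) hz
    · have := Finset.mem_toLeft.2 hz
      simp [hT] at this
    · exact ⟨p, rfl⟩
  refine le_antisymm (algRank_le_of_subset_closure (Set.iUnion₂_subset fun z hz => ?_)) ?_
  · obtain ⟨p, rfl⟩ := hinr z hz
    rw [← algClosureOf_ratioSet_prodOn]
    exact subset_algClosureOf _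
  · obtain ⟨z, hz⟩ := hne
    obtain ⟨p, rfl⟩ := hinr z hz
    exact algRank_le_of_subset_closure (ratioSet_subset_of_inr hz)

theorem ratioRank_comp {ι : Type} {l : ℕ} (F : ι → LinearSeries X) (f : Fin l ↪ ι)
    (I : Finset (Fin l)) : ratioRank (fun p => F (f p)) I = ratioRank F (I.map f) := by
  rw [ratioRank, ratioRank]
  congr 1
  ext z
  simp

/-- The inclusion of a subcollection of `E` and of all copies of the product. -/
structure IsReduction (J : Finset (Fin k)) (m : ℕ) {l : ℕ} (f : Fin l ↪ Fin k ⊕ Fin m) :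
    Prop where
  inl_mem : ∀ i, Sum.inl i ∈ Set.range f ↔ i ∉ J
  inr_mem : ∀ p, Sum.inr p ∈ Set.range f

/-- Here `m = τ_J + 1`, so all the copies together have defect `-1`. Let `I'` be the part of `I`
from the original series. If `I` contains a copy, then `τ_I ≥ τ_{J ∪ I'} ≥ |J| + |I'| - d` while
`|I| ≤ |I'| + m`, so its defect is at least `-1`. If not, then `τ_I ≥ τ_{J ∪ I'} - τ_J ≥ |I'|` and
its defect is non-negative. -/
theorem minDefect_adjoinProd {l : ℕ} {f : Fin l ↪ Fin k ⊕ Fin m} (hf : IsReduction J m f)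
    (hJ : E.defect J = E.minDefect) {d : ℕ} (hd : E.minDefect = -(d : ℤ)) (hm : m + d = J.card + 1)
    (hm0 : 0 < m) :
    Collection.minDefect (X := X) (fun p => E.adjoinProd J m (f p)) = -1 := by
  set W : Collection X l := fun p => E.adjoinProd J m (f p)
  have hW : ∀ I : Finset (Fin l), ((W.prodOn I).tau : ℕ∞) =
      ratioRank (E.adjoinProd J m) (I.map f) := fun I => by
    rw [coe_tau_prodOn, ratioRank_comp]
  have hτJ : ((E.prodOn J).tau : ℤ) = J.card - d := by
    have : ((E.prodOn J).tau : ℤ) - J.card = -d := hJ.trans hd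
    omega
  refine le_antisymm ?_ (Finset.le_inf' _ _ fun I _ => ?_)
  · let T : Finset (Fin k ⊕ Fin m) := Finset.univ.map Function.Embedding.inr
    let I : Finset (Fin l) := T.preimage f f.injective.injOn
    have hIT : I.map f = T := by
      ext z
      simp only [Finset.mem_map, I, Finset.mem_preimage]
      refine ⟨fun ⟨p, hp, h⟩ => h ▸ hp, fun h => ?_⟩
      obtain ⟨q, -, rfl⟩ := Finset.mem_map.1 h
      obtain ⟨p, hp⟩ := hf.inr_mem q
      exact ⟨p, by rw [hp]; exact h, hp⟩
    refine (W.minDefect_le I).trans ?_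
    have h1 := hW I
    rw [hIT, ratioRank_of_toLeft_eq_empty (by ext; simp)
      (Finset.map_nonempty.2 ⟨⟨0, hm0⟩, Finset.mem_univ _⟩), ← coe_tau_prodOn] at h1
    have h2 : I.card = m := by rw [← Finset.card_map f, hIT, Finset.card_map, Finset.card_univ, Fintype.card_fin]
    have h3 : (W.prodOn I).tau = (E.prodOn J).tau := by exact_mod_cast h1
    rw [defect, h2, h3, hτJ]
    omega
  · have hcard : (I.map f).toLeft.card + (I.map f).toRight.card = I.card := by
      rw [Finset.card_toLeft_add_card_toRight, Finset.card_map]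
    have hdisj : Disjoint J (I.map f).toLeft := by
      rw [Finset.disjoint_left]
      intro i hi hi'
      obtain ⟨p, -, hp⟩ := Finset.mem_map.1 (Finset.mem_toLeft.1 hi')
      exact (hf.inl_mem i).1 ⟨p, hp⟩ hi
    have hmin := (E.minDefect_le (J ∪ (I.map f).toLeft))
    rw [hd, defect, Finset.card_union_of_disjoint hdisj] at hmin
    have hright : (I.map f).toRight.card ≤ m := by
      simpa using Finset.card_le_univ (I.map f).toRight
    rw [defect]
    rcases (I.map f).toRight.eq_empty_or_nonempty with h0 | ⟨p, hp⟩
    · have h1 := (ratioRank_union_le E J (I.map f).toLeft).trans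
        (add_le_add_right (ratioRank_toLeft_le (J := J) (I.map f)) _)
      rw [← hW, ← coe_tau_prodOn, ← coe_tau_prodOn] at h1
      have h2 : (E.prodOn (J ∪ (I.map f).toLeft)).tau ≤
        (E.prodOn J).tau + (W.prodOn I).tau := by exact_mod_cast h1
      rw [h0, Finset.card_empty] at hcard
      omega
    · have h1 := ratioRank_union_toLeft_le (E := E) (J := J) (Finset.mem_toRight.1 hp)
      rw [← hW, ← coe_tau_prodOn] at h1
      have h2 : (E.prodOn (J ∪ (I.map f).toLeft)).tau ≤ (W.prodOn I).tau := by
        exact_mod_cast h1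
      omega

/-- Essentiality in the form that the dimension count needs, with cardinalities moved to one side.
-/
theorem ratioRank_lt_inl (hJ : E.IsEssential J) {I : Finset (Fin k ⊕ Fin m)}
    (hI : I ⊂ J.map Function.Embedding.inl) :
    ratioRank (E.adjoinProd J m) (J.map Function.Embedding.inl) <
      ratioRank (E.adjoinProd J m) I + (J.map Function.Embedding.inl \ I).card := by
  have hIE : I.toLeft.map Function.Embedding.inl = I := by
    ext (i | p)
    · simp
    · simp only [Finset.mem_map, Finset.mem_toLeft, Function.Embedding.inl_apply, reduceCtorEq,
        and_false, exists_false, false_iff]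
      intro h
      simpa using hI.1 h
  have hlt : I.toLeft ⊂ J := by
    rw [← hIE] at hI
    exact Finset.map_ssubset_map.1 hI
  have h1 := hJ.2 _ hlt
  have key : ∀ S : Finset (Fin k), ratioRank (E.adjoinProd J m)
      (S.map Function.Embedding.inl) = (E.prodOn S).tau := fun S => by
    rw [coe_tau_prodOn, ratioRank, ratioRank]
    congr 1
    ext z
    simp [adjoinProd]
  rw [← hIE, key, key, ← Finset.map_sdiff, Finset.card_map, Finset.card_sdiff_of_subset hlt.1]
  have h2 := Finset.card_le_card hlt.1
  rw [defect, defect] at h1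
  have h3 : (E.prodOn J).tau < (E.prodOn I.toLeft).tau + (J.card - I.toLeft.card) := by omega
  exact_mod_cast h3

/-- Every non-empty set of copies has rank `τ_J`, so dropping copies only changes the cardinality.
The empty set is where `τ_J < m` is needed. -/
theorem ratioRank_lt_inr (hJ : (E.prodOn J).tau < m) {I : Finset (Fin k ⊕ Fin m)}
    (hI : I ⊂ Finset.univ.map Function.Embedding.inr) :
    ratioRank (E.adjoinProd J m) (Finset.univ.map Function.Embedding.inr) <
      ratioRank (E.adjoinProd J m) I +
        (Finset.univ.map (Function.Embedding.inr : Fin m ↪ Fin k ⊕ Fin m) \ I).card := by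
  have hleft : ∀ I : Finset (Fin k ⊕ Fin m), I ⊆ Finset.univ.map Function.Embedding.inr →
      I.toLeft = ∅ := by
    intro I hI
    ext i
    simp only [Finset.mem_toLeft, Finset.notMem_empty, iff_false]
    intro h
    simpa using hI h
  have hpos := Finset.card_pos.2 (Finset.sdiff_nonempty.2 hI.2)
  rw [ratioRank_of_toLeft_eq_empty (hleft _ subset_rfl)
    (Finset.Nonempty.mono Finset.sdiff_subset (Finset.sdiff_nonempty.2 hI.2)), ← coe_tau_prodOn]
  rcases I.eq_empty_or_nonempty with rfl | hne
  · rw [ratioRank_empty, zero_add, Finset.sdiff_empty, Finset.card_map, Finset.card_univ,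
      Fintype.card_fin]
    exact_mod_cast hJ
  · rw [ratioRank_of_toLeft_eq_empty (hleft _ hI.1) hne, ← coe_tau_prodOn]
    exact_mod_cast Nat.lt_add_of_pos_right hpos

end Collection

end

/-! ### The universal system over a chart and the consistency variety. -/

noncomputable section

namespace LinearSeries

variable {X : ComplexVariety} {ι : Type} {F : ι → LinearSeries X}

/-- The index set of the basis sections of a family of linear series. -/
abbrev BasisIdx (F : ι → LinearSeries X) : Type := Σ i, Fin (Module.finrank ℂ (F i).space)

namespace NormalChart

/-- The coordinates of the universal system that vanishes at the universal point of a chart. -/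
def universal (C : NormalChart F) :
    MvPolynomial (BasisIdx F) ℂ →ₐ[ℂ] MvPolynomial (BasisIdx F) C.A :=
  MvPolynomial.aeval (univSection C.a C.j₀)

/-- The universal system over the function field. -/
def universalFun (C : NormalChart F) :
    MvPolynomial (BasisIdx F) ℂ →ₐ[ℂ] MvPolynomial (BasisIdx F) X.FunField :=
  MvPolynomial.aeval (univSection (fun i j => C.emb (C.a i j)) C.j₀)

theorem mapAlgHom_universal (C : NormalChart F) (g : MvPolynomial (BasisIdx F) ℂ) :
    MvPolynomial.mapAlgHom C.emb (C.universal g) = C.universalFun g := by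
  rw [universal, universalFun, MvPolynomial.comp_aeval_apply]
  congr 2
  funext p
  simp [univSection, apply_ite (MvPolynomial.map _)]

/-- Over the function field two charts differ by rescaling each vector `a i`. Hence the universal
section of `C'` also vanishes at the universal point of `C`, and substituting it makes the
correction term of `C` zero. -/
theorem universalFun_eq (C C' : NormalChart F) (g : MvPolynomial (BasisIdx F) ℂ) :
    MvPolynomial.aeval (univSection (fun i j => C'.emb (C'.a i j)) C'.j₀) (C.universalFun g) =
      C'.universalFun g := by
  let θ : MvPolynomial (BasisIdx F) X.FunField →ₐ[X.FunField] MvPolynomial (BasisIdx F) X.FunField :=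
    MvPolynomial.aeval (univSection (fun i j => C'.emb (C'.a i j)) C'.j₀)
  change θ.restrictScalars ℂ (C.universalFun g) = _
  rw [universalFun, universalFun, MvPolynomial.comp_aeval_apply]
  congr 2
  funext p
  have h1 : ∀ i l, C.emb (C.a i l) = C.emb (C.a i (C'.j₀ i)) * C'.emb (C'.a i l) := by
    intro i l
    refine mul_right_cancel₀ (C.gen_ne_zero i) ?_
    rw [C.emb_a_mul, mul_right_comm, C.emb_a_mul, mul_comm, C'.emb_a_mul]
  have h2 : ∑ l, MvPolynomial.C (C.emb (C.a p.1 l)) *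
      univSection (fun i j => C'.emb (C'.a i j)) C'.j₀ ⟨p.1, l⟩ = 0 := by
    have h3 := sum_C_mul_univSection (a := fun i j => C'.emb (C'.a i j)) (j₀ := C'.j₀) (i := p.1)
      (by rw [C'.a_j₀, map_one])
    refine (Finset.sum_congr rfl fun l _ => ?_).trans
      ((Finset.mul_sum _ _ (MvPolynomial.C (C.emb (C.a p.1 (C'.j₀ p.1))))).symm.trans
        (by rw [h3, mul_zero]))
    rw [h1 p.1 l, map_mul, mul_assoc]
  conv_lhs => rw [univSection]
  simp only [AlgHom.restrictScalars_apply, map_sub, apply_ite θ, map_sum, map_mul, map_zero,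
    MvPolynomial.algHom_C, MvPolynomial.algebraMap_eq, θ, MvPolynomial.aeval_X, h2, ite_self,
    sub_zero]

/-- Relations can be tested on a single chart, although the zeros of a system may lie in any. -/
theorem universal_eq_zero (C C' : NormalChart F) {g : MvPolynomial (BasisIdx F) ℂ}
    (h : C.universal g = 0) : C'.universal g = 0 := by
  have hinj : Function.Injective (MvPolynomial.mapAlgHom (σ := BasisIdx F) C'.emb) :=
    MvPolynomial.map_injective _ C'.emb_injective
  refine hinj ?_
  rw [map_zero, mapAlgHom_universal, ← universalFun_eq C, ← mapAlgHom_universal, h, map_zero,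
    map_zero]

/-- A relation between the coordinates of the universal system holds for all systems with a common
zero. -/
theorem eval_eq_zero_of_universal (C C' : NormalChart F) {g : MvPolynomial (BasisIdx F) ℂ}
    (h : C.universal g = 0) (q : ClosedPt C'.A) {c : BasisIdx F → ℂ}
    (hc : ∀ i, ∑ j, q (C'.a i j) * c ⟨i, j⟩ = 0) : MvPolynomial.eval c g = 0 := by
  let P : MvPolynomial (BasisIdx F) C'.A →ₐ[ℂ] ℂ :=
    MvPolynomial.aevalTower (q : C'.A →ₐ[ℂ] ℂ) c
  have hPX : ∀ p, P (MvPolynomial.X p) = c p := MvPolynomial.aevalTower_X _ _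
  have hPC : ∀ a, P (MvPolynomial.C a) = q a := MvPolynomial.aevalTower_C _ _
  -- Since `c` already vanishes at `q`, its correction term is zero.
  have hP : ∀ p, P (univSection C'.a C'.j₀ p) = c p := by
    intro p
    simp only [univSection, map_sub, apply_ite P, map_sum, map_mul, map_zero, hPX, hPC, hc,
      ite_self, sub_zero]
  have h1 := MvPolynomial.comp_aeval_apply (univSection C'.a C'.j₀) P g
  simp only [hP] at h1
  have h2 := C.universal_eq_zero C' h
  rw [universal] at h2
  rw [h2, map_zero] at h1
  exact h1.symm

variable (C : NormalChart F)

instance [Fintype ι] : Algebra.FiniteType ℂ (MvPolynomial (BasisIdx F) C.A) :=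
  Algebra.FiniteType.trans (S := C.A) inferInstance inferInstance

/-- The point of a chart under a point of the universal family of systems. -/
def basePt (P : ClosedPt (MvPolynomial (BasisIdx F) C.A)) : ClosedPt C.A :=
  ClosedPt.comap (IsScalarTower.toAlgHom ℂ C.A _) P

theorem basePt_apply (P : ClosedPt (MvPolynomial (BasisIdx F) C.A)) (a : C.A) :
    C.basePt P a = P (MvPolynomial.C a) := rfl

theorem sum_basePt_mul (P : ClosedPt (MvPolynomial (BasisIdx F) C.A)) (i) :
    ∑ j, C.basePt P (C.a i j) * P (univSection C.a C.j₀ ⟨i, j⟩) = 0 := by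
  simp only [basePt_apply, ← map_mul, ← map_sum, sum_C_mul_univSection (C.a_j₀ i), map_zero]

end NormalChart

end LinearSeries

namespace Collection

open LinearSeries

variable {X : ComplexVariety} {k : ℕ}

/-- The coordinates on the space of systems. -/
abbrev sysBasis (E : Collection X k) : Module.Basis (BasisIdx E) ℂ E.Systems :=
  Pi.basis fun p => (E p).basis

/-- A system as a point of affine space. -/
def sysPt (E : Collection X k) (s : E.Systems) : ClosedPt (MvPolynomial (BasisIdx E) ℂ) :=
  coordPt E.sysBasis.coord s

theorem sysPt_X (E : Collection X k) (s : E.Systems) (p) (j) :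
    E.sysPt s (MvPolynomial.X ⟨p, j⟩) = (E p).basis.repr (s p) j := by
  rw [sysPt, coordPt_apply, MvPolynomial.eval_X]
  exact Pi.basis_repr (fun p => (E p).basis) s ⟨p, j⟩

theorem zariskiTopology_systems (E : Collection X k) :
    zariskiTopology E.Systems = induced E.sysPt inferInstance := by
  refine zariskiTopology_eq_induced _ ?_
  rw [← Module.Basis.coe_dualBasis, Module.Basis.span_eq]

theorem isOpen_systems_iff (E : Collection X k) {O : Set E.Systems} :
    IsOpen[zariskiTopology E.Systems] O ↔
      ∃ O' : Set (ClosedPt (MvPolynomial (BasisIdx E) ℂ)), IsOpen O' ∧ E.sysPt ⁻¹' O' = O := by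
  rw [zariskiTopology_systems, isOpen_induced_iff]

/-- The system with given coordinates. -/
def ofPt (E : Collection X k) (u : ClosedPt (MvPolynomial (BasisIdx E) ℂ)) : E.Systems :=
  fun p => ∑ j, u (MvPolynomial.X ⟨p, j⟩) • (E p).basis j

theorem repr_ofPt (E : Collection X k) (u : ClosedPt (MvPolynomial (BasisIdx E) ℂ)) (p j) :
    (E p).basis.repr (E.ofPt u p) j = u (MvPolynomial.X ⟨p, j⟩) := by
  rw [ofPt, Module.Basis.repr_sum_self]

theorem sysPt_ofPt (E : Collection X k) (u : ClosedPt (MvPolynomial (BasisIdx E) ℂ)) :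
    E.sysPt (E.ofPt u) = u :=
  MvPolynomial.algHom_ext fun ⟨p, j⟩ => (E.sysPt_X _ p j).trans (E.repr_ofPt u p j)

theorem ofPt_sysPt (E : Collection X k) (s : E.Systems) : E.ofPt (E.sysPt s) = s := by
  funext p
  refine (E p).basis.repr.injective (Finsupp.ext fun j => ?_)
  rw [repr_ofPt, sysPt_X]

section Universal

variable {ι : Type} {F : ι → LinearSeries X} (C : NormalChart F) (f : Fin k ↪ ι)

/-- The subfamily of a family of linear series, as a collection. -/
abbrev ofFamily (F : ι → LinearSeries X) (f : Fin k ↪ ι) : Collection X k := fun p => F (f p)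

/-- The inclusion of the indices of basis sections. -/
def idxEmb (F : ι → LinearSeries X) (f : Fin k ↪ ι) (z : BasisIdx (ofFamily F f)) : BasisIdx F :=
  ⟨f z.1, z.2⟩

theorem idxEmb_injective : Function.Injective (idxEmb F f) := by
  rintro ⟨p, j⟩ ⟨p', j'⟩ h
  obtain rfl : p = p' := f.injective (congrArg Sigma.fst h)
  obtain rfl : j = j' := eq_of_heq (Sigma.mk.inj h).2
  rfl

/-- The coordinates of the universal system of a subfamily. -/
def universalOn : MvPolynomial (BasisIdx (ofFamily F f)) ℂ →ₐ[ℂ] MvPolynomial (BasisIdx F) C.A :=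
  C.universal.comp (MvPolynomial.rename (idxEmb F f))

theorem universalOn_X (p j) : universalOn C f (MvPolynomial.X ⟨p, j⟩) =
    univSection C.a C.j₀ ⟨f p, j⟩ := by
  simp [universalOn, NormalChart.universal, idxEmb]

/-- The systems in the universal family. -/
def system (P : ClosedPt (MvPolynomial (BasisIdx F) C.A)) : (ofFamily F f).Systems :=
  (ofFamily F f).ofPt (ClosedPt.comap (universalOn C f) P)

theorem repr_system (P : ClosedPt (MvPolynomial (BasisIdx F) C.A)) (p j) :
    (F (f p)).basis.repr (system C f P p) j = P (univSection C.a C.j₀ ⟨f p, j⟩) := by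
  exact (repr_ofPt (ofFamily F f) (ClosedPt.comap (universalOn C f) P) p j).trans
    (congrArg P (universalOn_X C f p j))

theorem system_mem_vanishing_iff (P : ClosedPt (MvPolynomial (BasisIdx F) C.A))
    {C' : NormalChart F} {q : ClosedPt C'.A} {x : X.carrier} (h : C'.IsAt q x) (p) :
    (system C f P p).1 ∈ (F (f p)).bundle.vanishing x ↔
      ∑ j, q (C'.a (f p) j) * P (univSection C.a C.j₀ ⟨f p, j⟩) = 0 := by
  rw [h]
  simp only [repr_system]

theorem mem_zeroSet_system (P : ClosedPt (MvPolynomial (BasisIdx F) C.A)) {x : X.carrier}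
    (hx : x ∈ X.points) (h : C.IsAt (C.basePt P) x) :
    x ∈ (ofFamily F f).zeroSet (system C f P) :=
  ⟨hx, fun p => (system_mem_vanishing_iff C f P h p).2 (C.sum_basePt_mul P _)⟩

/-- The universal family over one chart already has dense image, so the kernel of `universalOn`
gives the equations of the consistency variety. -/
theorem mem_consistencyVariety_iff [Fintype ι] {s : (ofFamily F f).Systems} :
    s ∈ (ofFamily F f).consistencyVariety ↔
      ∀ g, universalOn C f g = 0 → (ofFamily F f).sysPt s g = 0 := by
  let _ : TopologicalSpace (ofFamily F f).Systems := zariskiTopology _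
  constructor
  · intro hs g hg
    have hclosed : IsClosed {s | (ofFamily F f).sysPt s g = 0} := by
      rw [← isOpen_compl_iff]
      exact (isOpen_systems_iff _).2 ⟨_, ClosedPt.isOpen_ne g, rfl⟩
    refine closure_minimal ?_ hclosed hs
    rintro _ ⟨⟨x, s⟩, ⟨hx, hxs⟩, rfl⟩
    obtain ⟨κ, _, _, C', hC'⟩ := exists_normalCharts F
    obtain ⟨α, q, hq⟩ := hC' x hx
    -- Series outside the subfamily receive the zero section, which vanishes everywhere.
    let c : BasisIdx F → ℂ := Function.extend (idxEmb F f)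
      (fun z => (F (f z.1)).basis.repr (s z.1) z.2) 0
    have hcf : ∀ z, c (idxEmb F f z) = (F (f z.1)).basis.repr (s z.1) z.2 :=
      (idxEmb_injective f).extend_apply _ _
    have hc : ∀ i, ∑ j, q ((C' α).a i j) * c ⟨i, j⟩ = 0 := by
      intro i
      by_cases hi : ∃ p, f p = i
      · obtain ⟨p, rfl⟩ := hi
        rw [← (hq (f p) (s p)).1 (hxs p)]
        exact Finset.sum_congr rfl fun j _ => congrArg _ (hcf ⟨p, j⟩)
      · refine Finset.sum_eq_zero fun j _ => ?_
        have : c ⟨i, j⟩ = 0 := Function.extend_apply' _ _ _ (by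
          rintro ⟨z, hz⟩
          exact hi ⟨z.1, congrArg Sigma.fst hz⟩)
        rw [this, mul_zero]
    have h1 : MvPolynomial.eval c (MvPolynomial.rename (idxEmb F f) g) = 0 :=
      C.eval_eq_zero_of_universal (C' α) hg q hc
    rw [MvPolynomial.eval_rename] at h1
    refine (coordPt_apply _ _ _).trans (Eq.trans ?_ h1)
    congr 2
    funext ⟨p, j⟩
    exact (Pi.basis_repr (fun p => (F (f p)).basis) s ⟨p, j⟩).trans (hcf ⟨p, j⟩).symm
  · intro hs
    refine mem_closure_iff.2 fun O hO hsO => ?_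
    obtain ⟨O', hO', rfl⟩ := (isOpen_systems_iff _).1 hO
    obtain ⟨G, rfl⟩ := ClosedPt.isOpen_iff.1 hO'
    obtain ⟨g, hg, hsg⟩ := hsO
    -- A polynomial that is non-zero at `s` is not a relation, so it is non-zero at some system of
    -- the universal family.
    obtain ⟨P, hP⟩ := ClosedPt.exists_apply_ne_zero (g := universalOn C f g) (mt (hs g) hsg)
    obtain ⟨x, hx, hq⟩ := C.exists_point (C.basePt P)
    refine ⟨system C f P, ⟨g, hg, ?_⟩, ⟨x, _⟩, mem_zeroSet_system C f P hx hq, rfl⟩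
    rw [system, sysPt_ofPt]
    exact hP

/-- `O` is left free because one open set of parameters has to serve two subfamilies. -/
theorem exists_isGenericSubset [Fintype ι] : ∃ h : MvPolynomial (BasisIdx F) C.A, h ≠ 0 ∧
    ∀ O : Set (ClosedPt (MvPolynomial (BasisIdx F) C.A)), IsOpen O →
      (O ∩ {P | P h ≠ 0}).Nonempty →
      (ofFamily F f).IsGenericSubset (system C f '' (O ∩ {P | P h ≠ 0})) := by
  obtain ⟨h, h0, H⟩ := exists_isOpen_image (universalOn C f)
  refine ⟨h, h0, fun O hO hne => ⟨hne.image _, ?_⟩⟩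
  obtain ⟨O', hO', hE⟩ := H O hO
  refine ⟨(ofFamily F f).sysPt ⁻¹' O', (isOpen_systems_iff _).2 ⟨O', hO', rfl⟩, ?_⟩
  ext s
  rw [Set.mem_inter_iff, mem_consistencyVariety_iff C f]
  refine Iff.trans ?_ (Set.ext_iff.1 hE ((ofFamily F f).sysPt s))
  constructor
  · rintro ⟨P, hP, rfl⟩
    exact ⟨P, hP, (sysPt_ofPt _ _).symm⟩
  · rintro ⟨P, hP, hs⟩
    refine ⟨P, hP, ?_⟩
    rw [system, hs, ofPt_sysPt]

/-- The generic system of a strict subfamily determines the hyperplanes of this subfamily at all of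
its zeros. -/
theorem exists_hyperplane_eq [Fintype ι] [DecidableEq ι] {J : Finset ι}
    (hJ : ∀ I ⊂ J, ratioRank F J < ratioRank F I + (J \ I).card) :
    ∃ h : MvPolynomial (BasisIdx F) C.A, h ≠ 0 ∧
      ∀ P : ClosedPt (MvPolynomial (BasisIdx F) C.A), P h ≠ 0 →
        ∀ x y : X.carrier, C.IsAt (C.basePt P) y → x ∈ X.points → ↑J ⊆ Set.range f →
          (∀ p, f p ∈ J → (system C f P p).1 ∈ (F (f p)).bundle.vanishing x) →
          ∀ i ∈ J, (F i).hyperplane x = (F i).hyperplane y := by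
  obtain ⟨κ, _, _, C', hC'⟩ := exists_normalCharts F
  -- The second zero may lie in any chart; the product of the finitely many conditions covers them
  -- all.
  choose g hg0 hg using fun α => exists_generic_unique_zero C.a_j₀ (J := J)
    (fun I hI => by
      rw [algRank_normalChart, algRank_normalChart]
      exact hJ I hI) (C' α).a_j₀ (by rw [algRank_normalChart, algRank_normalChart])
  refine ⟨∏ α, g α, Finset.prod_ne_zero_iff.2 fun α _ => hg0 α,
    fun P hP x y hy hx hJf hPx i hi => ?_⟩
  obtain ⟨α, q, hq⟩ := hC' x hx
  rw [map_prod, Finset.prod_ne_zero_iff] at hP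
  have h1 := hg α P (hP α (Finset.mem_univ α)) q (fun i hi => by
    obtain ⟨p, rfl⟩ := hJf hi
    exact (system_mem_vanishing_iff C f P hq p).1 (hPx p hi)) i hi
  -- Otherwise all coordinates of series `i` at `x` would be zero, against the normalization of `C'
  -- α`.
  have h2 : q ((C' α).a i (C.j₀ i)) ≠ 0 := by
    intro h0
    have h3 := h1 ((C' α).j₀ i)
    rw [h0, zero_mul, (C' α).a_j₀, map_one] at h3
    exact one_ne_zero h3
  ext s
  refine (hq i s).trans (Iff.trans ?_ (hy i s).symm)
  have h3 : ∑ j, q ((C' α).a i j) * (F i).basis.repr s j =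
      q ((C' α).a i (C.j₀ i)) * ∑ j, C.basePt P (C.a i j) * (F i).basis.repr s j := by
    rw [Finset.mul_sum]
    refine Finset.sum_congr rfl fun j _ => ?_
    rw [h1 j, mul_assoc, C.basePt_apply]
  rw [h3, mul_eq_zero, or_iff_right h2]

end Universal

/-- Two subfamilies of a family of linear series are equivalent if they only differ in strict
subfamilies that have the same fibers. -/
theorem equivalent_ofFamily {l : ℕ} {ι : Type} [Fintype ι] [DecidableEq ι]
    {F : ι → LinearSeries X} {f : Fin k ↪ ι} {f' : Fin l ↪ ι} {J J' : Finset ι}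
    (hJf : ↑J ⊆ Set.range f) (hJf' : ↑J' ⊆ Set.range f')
    (hff' : ∀ i, i ∈ Set.range f ∧ i ∉ J ↔ i ∈ Set.range f' ∧ i ∉ J')
    (hJ : ∀ I ⊂ J, ratioRank F J < ratioRank F I + (J \ I).card)
    (hJ' : ∀ I ⊂ J', ratioRank F J' < ratioRank F I + (J' \ I).card)
    (hJJ' : ∀ x ∈ X.points, ∀ y ∈ X.points,
      (∀ i ∈ J, (F i).hyperplane x = (F i).hyperplane y) ↔
        ∀ i ∈ J', (F i).hyperplane x = (F i).hyperplane y) :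
    (ofFamily F f).Equivalent (ofFamily F f') := by
  obtain ⟨κ, _, ⟨α⟩, C', -⟩ := exists_normalCharts F
  let C := C' α
  obtain ⟨h₁, h₁0, H₁⟩ := exists_isGenericSubset C f
  obtain ⟨h₂, h₂0, H₂⟩ := exists_isGenericSubset C f'
  obtain ⟨g₁, g₁0, G₁⟩ := exists_hyperplane_eq C f hJ
  obtain ⟨g₂, g₂0, G₂⟩ := exists_hyperplane_eq C f' hJ'
  let O : Set (ClosedPt (MvPolynomial (BasisIdx F) C.A)) := {P | P (h₁ * h₂ * g₁ * g₂) ≠ 0}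
  have hO : IsOpen O := ClosedPt.isOpen_ne _
  have hO' : ∀ P ∈ O, P h₁ ≠ 0 ∧ P h₂ ≠ 0 ∧ P g₁ ≠ 0 ∧ P g₂ ≠ 0 := by
    intro P hP
    simpa only [O, Set.mem_ofPred_eq, map_mul, mul_ne_zero_iff, and_assoc] using hP
  have hne : O.Nonempty := ClosedPt.exists_apply_ne_zero
    (mul_ne_zero (mul_ne_zero (mul_ne_zero h₁0 h₂0) g₁0) g₂0)
  have hO₁ : O ∩ {P | P h₁ ≠ 0} = O := Set.inter_eq_left.2 fun P hP => (hO' P hP).1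
  have hO₂ : O ∩ {P | P h₂ ≠ 0} = O := Set.inter_eq_left.2 fun P hP => (hO' P hP).2.1
  have H₁' := H₁ O hO (by rwa [hO₁])
  have H₂' := H₂ O hO (by rwa [hO₂])
  rw [hO₁] at H₁'
  rw [hO₂] at H₂'
  -- The equations in `T` enter only through the fibre of `y`. The others are expressed by
  -- coordinates indexed by `ι`, so that the two subfamilies can be compared.
  have key : ∀ {n : ℕ} (e : Fin n ↪ ι) (T : Finset ι) (_ : ↑T ⊆ Set.range e)
      (P : ClosedPt (MvPolynomial (BasisIdx F) C.A)) (y : X.carrier),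
      C.IsAt (C.basePt P) y → (∀ x ∈ X.points,
        (∀ p, e p ∈ T → (system C e P p).1 ∈ (F (e p)).bundle.vanishing x) →
        ∀ i ∈ T, (F i).hyperplane x = (F i).hyperplane y) → ∀ x ∈ X.points,
      (x ∈ (ofFamily F e).zeroSet (system C e P) ↔
        (∀ i ∈ T, (F i).hyperplane x = (F i).hyperplane y) ∧
        ∀ i, i ∈ Set.range e ∧ i ∉ T → ∃ s : (F i).space,
          (∀ j, (F i).basis.repr s j = P (univSection C.a C.j₀ ⟨i, j⟩)) ∧
          s.1 ∈ (F i).bundle.vanishing x) := by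
    intro n e T hT P y hy hG x hx
    constructor
    · rintro ⟨-, hz⟩
      refine ⟨hG x hx fun p _ => hz p, ?_⟩
      rintro _ ⟨⟨p, rfl⟩, -⟩
      exact ⟨system C e P p, repr_system C e P p, hz p⟩
    · rintro ⟨hT', hs⟩
      refine ⟨hx, fun p => ?_⟩
      by_cases hp : e p ∈ T
      · change system C e P p ∈ (F (e p)).hyperplane x
        rw [hT' _ hp]
        exact (system_mem_vanishing_iff C e P hy p).2 (C.sum_basePt_mul P _)
      · obtain ⟨s, hs1, hs2⟩ := hs _ ⟨⟨p, rfl⟩, hp⟩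
        have : system C e P p = s := (F (e p)).basis.repr.injective (Finsupp.ext fun j => by
          rw [hs1, repr_system])
        rwa [this]
  have hZ : ∀ P ∈ O, (ofFamily F f).zeroSet (system C f P) =
      (ofFamily F f').zeroSet (system C f' P) := by
    intro P hP
    obtain ⟨y, hy, hyP⟩ := C.exists_point (C.basePt P)
    ext x
    by_cases hx : x ∈ X.points
    · rw [key f J hJf P y hyP (fun x hx h => G₁ P (hO' P hP).2.2.1 x y hyP hx hJf h) x hx,
        key f' J' hJf' P y hyP (fun x hx h => G₂ P (hO' P hP).2.2.2 x y hyP hx hJf' h) x hx,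
        hJJ' x hx y hy]
      simp only [hff']
    · exact ⟨fun h => absurd h.1 hx, fun h => absurd h.1 hx⟩
  refine ⟨_, _, H₁', H₂', ?_, ?_⟩
  · rintro _ ⟨P, hP, rfl⟩
    exact ⟨_, ⟨P, hP, rfl⟩, hZ P hP⟩
  · rintro _ ⟨P, hP, rfl⟩
    exact ⟨_, ⟨P, hP, rfl⟩, hZ P hP⟩

end Collection

end

/-! ### The reduction theorem. -/

noncomputable section

namespace Collection

open LinearSeries

variable {X : ComplexVariety} {k : ℕ} {E : Collection X k} {J : Finset (Fin k)}

theorem le_card_of_minDefect (hJ : E.defect J = E.minDefect) {d : ℕ}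
    (hd : E.minDefect = -(d : ℤ)) : d ≤ J.card := by
  rw [hd, defect] at hJ
  omega

/-- The reduction theorem for an essential subcollection. -/
theorem equivalent_adjoinProd (hJ : E.IsEssential J) {d m l : ℕ} (hd : E.minDefect = -(d : ℤ))
    (hm : m + d = J.card + 1) {f : Fin l ↪ Fin k ⊕ Fin m} (hf : IsReduction J m f) :
    E.Equivalent (ofFamily (E.adjoinProd J m) f) := by
  have hτ : ((E.prodOn J).tau : ℤ) - J.card = -d := hJ.1.trans hd
  have hdJ := le_card_of_minDefect hJ.1 hd
  -- As `τ_J = |J| - d`, the relation `hm` says `m = τ_J + 1`, which makes the copies strict.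
  refine equivalent_ofFamily (F := E.adjoinProd J m) (f := Function.Embedding.inl)
    (J := J.map Function.Embedding.inl) (J' := Finset.univ.map Function.Embedding.inr)
    ?_ ?_ ?_ (fun I => ratioRank_lt_inl hJ) (fun I => ratioRank_lt_inr (by omega)) ?_
  · intro z hz
    obtain ⟨i, -, rfl⟩ := Finset.mem_map.1 hz
    exact ⟨i, rfl⟩
  · intro z hz
    obtain ⟨p, -, rfl⟩ := Finset.mem_map.1 hz
    exact hf.inr_mem p
  · rintro (i | p)
    · rw [hf.inl_mem]
      simp
    · simp
  · intro x hx y hy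
    have h := hyperplane_prod_eq_iff (fun j : J => E j) (x := x) (y := y) hx
    constructor
    · intro hxy z hz
      obtain ⟨p, -, rfl⟩ := Finset.mem_map.1 hz
      exact h.2 fun j => hxy (Sum.inl j) (Finset.mem_map_of_mem _ j.2)
    · intro hxy z hz
      obtain ⟨i, hi, rfl⟩ := Finset.mem_map.1 hz
      exact h.1 (hxy (Sum.inr ⟨0, by omega⟩) (Finset.mem_map_of_mem _ (Finset.mem_univ _))) ⟨i, hi⟩

/-- An essential `J` need not be an initial segment; for mere existence any enumeration of the
remaining series and the copies will do. -/
theorem exists_isReduction (J : Finset (Fin k)) (m : ℕ) :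
    ∃ (l : ℕ) (f : Fin l ↪ Fin k ⊕ Fin m), IsReduction J m f := by
  let T : Finset (Fin k ⊕ Fin m) := Jᶜ.disjSum Finset.univ
  have hr : ∀ z, z ∈ Set.range (T.equivFin.symm.toEmbedding.trans (.subtype _)) ↔ z ∈ T := by
    intro z
    constructor
    · rintro ⟨p, rfl⟩
      exact (T.equivFin.symm p).2
    · intro hz
      exact ⟨T.equivFin ⟨z, hz⟩, by simp⟩
  refine ⟨_, T.equivFin.symm.toEmbedding.trans (.subtype _), fun i => ?_, fun p => ?_⟩
  · rw [hr, Finset.inl_mem_disjSum, Finset.mem_compl]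
  · rw [hr, Finset.inr_mem_disjSum]
    exact Finset.mem_univ p

theorem card_initial {r : ℕ} (hr : r ≤ k) : (initial k r).card = r := by
  rw [initial, Fin.card_filter_val_lt, min_eq_right hr]

/-- The inclusion of the indices behind an initial segment, and of all copies of the product. -/
def replaceEmb (r m : ℕ) (hr : r ≤ k) : Fin (m + (k - r)) ↪ Fin k ⊕ Fin m where
  toFun := Fin.append Sum.inr fun i : Fin (k - r) => Sum.inl ⟨r + i, by omega⟩
  inj' := by
    intro a b
    refine Fin.addCases (fun a => ?_) (fun a => ?_) a <;>
      refine Fin.addCases (fun b => ?_) (fun b => ?_) b <;>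
      simp [Fin.append_left, Fin.append_right, Fin.ext_iff]

theorem replaceEmb_castAdd (r m : ℕ) (hr : r ≤ k) (p : Fin m) :
    replaceEmb r m hr (Fin.castAdd _ p) = Sum.inr p :=
  Fin.append_left (Sum.inr : Fin m → Fin k ⊕ Fin m)
    (fun i : Fin (k - r) => Sum.inl ⟨r + i, by omega⟩) p

theorem replaceEmb_natAdd (r m : ℕ) (hr : r ≤ k) (p : Fin (k - r)) :
    replaceEmb r m hr (Fin.natAdd _ p) = Sum.inl ⟨r + p, by omega⟩ :=
  Fin.append_right (Sum.inr : Fin m → Fin k ⊕ Fin m)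
    (fun i : Fin (k - r) => Sum.inl ⟨r + i, by omega⟩) p

theorem isReduction_replaceEmb (r m : ℕ) (hr : r ≤ k) :
    IsReduction (initial k r) m (replaceEmb r m hr) where
  inl_mem i := by
    have hi : i ∉ initial k r ↔ r ≤ i := by simp [initial]
    rw [hi]
    constructor
    · rintro ⟨a, ha⟩
      revert ha
      refine Fin.addCases (fun a => ?_) (fun a => ?_) a
      · simp [replaceEmb_castAdd]
      · rw [replaceEmb_natAdd, Sum.inl.injEq]
        rintro rfl
        exact Nat.le_add_right _ _
    · intro h
      refine ⟨Fin.natAdd m ⟨i - r, by omega⟩, ?_⟩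
      rw [replaceEmb_natAdd, Sum.inl.injEq]
      exact Fin.ext (Nat.add_sub_cancel' h)
  inr_mem p := ⟨_, replaceEmb_castAdd r m hr p⟩

theorem replaceInitial_eq (E : Collection X k) (r m : ℕ) (hr : r ≤ k) :
    E.replaceInitial r m hr = ofFamily (E.adjoinProd (initial k r) m) (replaceEmb r m hr) := by
  funext a
  refine Fin.addCases (fun a => ?_) (fun a => ?_) a
  · simp [replaceInitial, ofFamily, replaceEmb_castAdd, adjoinProd]
  · simp [replaceInitial, ofFamily, replaceEmb_natAdd, adjoinProd]

end Collection

end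

theorem mainTheorem7 (X : ComplexVariety) (k : ℕ) (E : Collection X k)
    (hE : E.GenericallyInconsistent) :
    (∃ (l : ℕ) (W : Collection X l), W.minDefect = -1 ∧ E.Equivalent W) ∧
    ∀ (d r : ℕ) (hr : r ≤ k), E.minDefect = -(d : ℤ) →
      E.IsEssential (Collection.initial k r) →
      d ≤ r ∧
      (E.replaceInitial r (r - d + 1) hr).minDefect = -1 ∧
      E.Equivalent (E.replaceInitial r (r - d + 1) hr) := by
  constructor
  · obtain ⟨J, hJ⟩ := E.exists_isEssential
    obtain ⟨d, hd⟩ := Int.exists_eq_neg_ofNat E.minDefect_nonpos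
    have hdJ := Collection.le_card_of_minDefect hJ.1 hd
    -- The truncated subtraction is exact because `d ≤ |J|`.
    have hm : J.card - d + 1 + d = J.card + 1 := by omega
    obtain ⟨l, f, hf⟩ := Collection.exists_isReduction J (J.card - d + 1)
    exact ⟨l, _, Collection.minDefect_adjoinProd hf hJ.1 hd hm (Nat.succ_pos _),
      Collection.equivalent_adjoinProd hJ hd hm hf⟩
  · intro d r hr hd hJ
    have hdr := Collection.le_card_of_minDefect hJ.1 hd
    have hm : r - d + 1 + d = (Collection.initial k r).card + 1 := by
      rw [Collection.card_initial hr] at hdr ⊢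
      omega
    have hf := Collection.isReduction_replaceEmb (k := k) r (r - d + 1) hr
    rw [Collection.replaceInitial_eq]
    rw [Collection.card_initial hr] at hdr
    exact ⟨hdr, Collection.minDefect_adjoinProd hf hJ.1 hd hm (Nat.succ_pos _),
      Collection.equivalent_adjoinProd hJ hd hm hf⟩
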